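/- Let $X_1,\dots,X_n$ be jointly distributed real random variables that have a joint density with respect to Lebesgue measure on $\mathbb{R}^n$, and for $S\subseteq[1:n]=\{1,\dots,n\}$ write $X_S=(X_i:i\in S)$ and let $f_S$ be the density of $X_S$. Let $h(X_S)=-\int f_S\log f_S$ be the differential entropy of $X_S$ (with $h(X_\emptyset)=0$), and assume that $h(X_S)$ exists and is finite for every $S\subseteq[1:n]$. For disjoint $S,T\subseteq[1:n]$ let $h(X_S\mid X_T)=-\int f_{S\cup T}(x)\log\frac{f_{S\cup T}(x)}{f_T(x_T)}\,dx$ be the conditional differential entropy, where $x_T$ denotes the coordinates of $x$ indexed by $T$. Put $[p+1:n]=\{p+1,\dots,n\}$, which is empty if $p=n$. Then, for all $k,p\in[1:n]$ with $k\le p$, $$h(X_{[1:n]})\;\le\;\frac{1}{\binom{p-1}{k-1}}\sum_{\substack{S\subseteq[1:p]\\|S|=k}}h(X_S\mid X_{[p+1:n]})+h(X_{[p+1:n]})\;\le\;\frac{1}{\binom{n-1}{k-1}}\sum_{\substack{S\subseteq[1:n]\\|S|=k}}h(X_S).$$ If $k<p$, equality holds in the first inequality if and only if $X_1,\dots,X_p$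 are conditionally independent given $X_{[p+1:n]}$; if $k=p$, the first inequality is always an equality. If $p<n$, equality holds in the second inequality if and only if (i) for every $S\subseteq[1:p]$ with $|S|=k$, the random variables $X_i$, $i\in S$, are mutually independent, (ii) for every $S\subseteq[1:p]$ with $|S|=k$, the random vector $X_S$ is independent of the random vector $X_{[p+1:n]}$, and (iii) $X_{p+1},\dots,X_n$ are mutually independent. If $p=n$, the second inequality is always an equality. -/

import Mathlib

open MeasureTheory ProbabilityTheory

noncomputable section

namespace HanEntropy

/-- The block `[1:p]` of the index set `[1:n]`; the index `i` of the mathematics is the element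
`i - 1` of `Fin n`. -/
def firstBlock (n p : ℕ) : Finset (Fin n) := Finset.univ.filter fun i => i.val < p

/-- The block `[p+1:n]` of the index set `[1:n]`. -/
def lastBlock (n p : ℕ) : Finset (Fin n) := Finset.univ.filter fun i => p ≤ i.val

variable {Ω : Type*} [MeasurableSpace Ω] {n : ℕ}

/-- The random vector `X_S = (X_i : i ∈ S)`. -/
def subvector (X : Fin n → Ω → ℝ) (S : Finset (Fin n)) : Ω → (S → ℝ) :=
  fun ω i => X i ω

/-- The joint density of `X_S` with respect to Lebesgue measure on `ℝ^S`. -/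
def density (X : Fin n → Ω → ℝ) (μ : Measure Ω) (S : Finset (Fin n)) : (S → ℝ) → ℝ :=
  fun x => (pdf (subvector X S) μ volume x).toReal

/-- The differential entropy of `X_S` exists and is finite. -/
def FiniteDiffEntropy (X : Fin n → Ω → ℝ) (μ : Measure Ω) (S : Finset (Fin n)) : Prop :=
  Integrable (fun x => density X μ S x * Real.log (density X μ S x)) volume

/-- Differential entropy `h(X_S) = -∫ f_S log f_S` (for `S = ∅` it is `0`). -/
def diffEntropy (X : Fin n → Ω → ℝ) (μ : Measure Ω) (S : Finset (Fin n)) : ℝ :=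
  -∫ x, density X μ S x * Real.log (density X μ S x)

/-- Conditional differential entropy
`h(X_S | X_T) = -∫ f_{S ∪ T}(x) log (f_{S ∪ T}(x) / f_T(x_T)) dx`. -/
def condDiffEntropy (X : Fin n → Ω → ℝ) (μ : Measure Ω) (S T : Finset (Fin n)) : ℝ :=
  -∫ x : (S ∪ T : Finset (Fin n)) → ℝ, density X μ (S ∪ T) x *
    Real.log (density X μ (S ∪ T) x /
      density X μ T (Finset.restrict₂ (π := fun _ => ℝ) Finset.subset_union_right x))

/-- The sigma-algebra generated by `X_T`. -/
abbrev sigmaOf (X : Fin n → Ω → ℝ) (T : Finset (Fin n)) : MeasurableSpace Ω :=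
  MeasurableSpace.comap (subvector X T) inferInstance

/-- The random variables `X_i`, `i ∈ S`, are conditionally (mutually) independent given `X_T`:
for all Borel sets, the conditional probability of `⋂ {X_i ∈ A_i}` given `X_T` is almost surely
the product of the conditional probabilities. (On a standard Borel space this is Mathlib's
`iCondIndepFun`, which is not available on an arbitrary probability space.) -/
def CondIndepGiven (X : Fin n → Ω → ℝ) (μ : Measure Ω) (S T : Finset (Fin n)) : Prop :=
  ∀ R ⊆ S, ∀ A : Fin n → Set ℝ, (∀ i ∈ R, MeasurableSet (A i)) →
    μ⟦⋂ i ∈ R, X i ⁻¹' A i | sigmaOf X T⟧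
      =ᵐ[μ] ∏ i ∈ R, μ⟦X i ⁻¹' A i | sigmaOf X T⟧

/-- The bound `(1 / C(p-1, k-1)) ∑_{S ⊆ [1:p], |S| = k} h(X_S | X_{[p+1:n]}) + h(X_{[p+1:n]})`. -/
def condHanBound (X : Fin n → Ω → ℝ) (μ : Measure Ω) (k p : ℕ) : ℝ :=
  1 / ((p - 1).choose (k - 1) : ℝ) *
      ∑ S ∈ (firstBlock n p).powersetCard k, condDiffEntropy X μ S (lastBlock n p)
    + diffEntropy X μ (lastBlock n p)

/-- The bound `(1 / C(n-1, k-1)) ∑_{S ⊆ [1:n], |S| = k} h(X_S)`. -/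
def hanBound (X : Fin n → Ω → ℝ) (μ : Measure Ω) (k : ℕ) : ℝ :=
  1 / ((n - 1).choose (k - 1) : ℝ) *
    ∑ S ∈ (Finset.univ : Finset (Fin n)).powersetCard k, diffEntropy X μ S

end HanEntropy

end

/-! The set function F(S) = h(X_S) is submodular and vanishes at the empty set. Everything except
the probabilistic reading of the equality cases is then combinatorics of such functions. With P =
[1:p] and L = [p+1:n], the chain rule turns the middle term into `condAverage F k P L`, an average
of the contraction F(S ∪ L) - F(L) over k-subsets S of P, plus F(L). The right-hand bound is the
same expression with ground set P ∪ L and nothing conditioned on.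

The first inequality is Han's inequality for the contraction (`IsSubmodular.han`), obtained by
climbing from k-subsets to (k+1)-subsets until only P is left. For k < p, equality forces the
contraction to be additive on P. The second inequality moves the elements of L into P one at a time
(`IsSubmodular.condAverage_insert`), and no move decreases the average. For nonempty L, equality
means F(S ∪ L) is the sum of its singleton values for every k-subset S of P.

Submodularity on disjoint blocks L, S, T is Gibbs' inequality for f_{LS} f_{LT} / f_L against the
joint density f_{LST} (`diffEntropy_add_le_of_disjoint`). Equality means that the two agree, which
is conditional independence of X_S and X_T given X_L. Splitting off one variable at a time
translates additivity of a contraction into mutual conditional independence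
(`condIndepGiven_iff_contract_eq_sum`). -/

namespace HanEntropy

/-! ### Han-type inequalities for submodular set functions. -/

section Submodular

variable {α : Type*} [DecidableEq α] {F G : Finset α → ℝ}

/-- A submodular set function. -/
def IsSubmodular (F : Finset α → ℝ) : Prop :=
  ∀ A B, F (A ∪ B) + F (A ∩ B) ≤ F A + F B

/-- The contraction `S ↦ F (S ∪ L) - F L` of a set function. -/
def contract (F : Finset α → ℝ) (L : Finset α) (S : Finset α) : ℝ := F (S ∪ L) - F L

theorem contract_empty (L : Finset α) : contract F L ∅ = 0 := by simp [contract]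

theorem IsSubmodular.contract (hF : IsSubmodular F) (L : Finset α) :
    IsSubmodular (contract F L) := by
  intro A B
  have h := hF (A ∪ L) (B ∪ L)
  rw [← Finset.union_union_distrib_right, ← Finset.inter_union_distrib_right] at h
  simp only [HanEntropy.contract]
  linarith

/-- Adding the elements of R to B one by one writes the right side as a telescoping sum of marginal
gains. By diminishing returns, each gain is at least the gain of the same element at the top. -/
theorem IsSubmodular.sum_sub_erase_le (hF : IsSubmodular F) (B R : Finset α)
    (h : Disjoint B R) :
    ∑ i ∈ R, (F (B ∪ R) - F ((B ∪ R).erase i)) ≤ F (B ∪ R) - F B := by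
  induction R using Finset.induction_on with
  | empty => simp
  | insert a R ha ih =>
    rw [Finset.disjoint_insert_right] at h
    have haBR : a ∉ B ∪ R := by simp [h.1, ha]
    have ih := ih h.2
    rw [Finset.sum_insert ha, Finset.union_insert, Finset.erase_insert haBR]
    have key : ∑ i ∈ R, (F (insert a (B ∪ R)) - F ((insert a (B ∪ R)).erase i)) ≤
        ∑ i ∈ R, (F (B ∪ R) - F ((B ∪ R).erase i)) := by
      refine Finset.sum_le_sum fun i hi => ?_
      have hia : i ≠ a := fun e => ha (e ▸ hi)
      have h1 := hF ((insert a (B ∪ R)).erase i) (B ∪ R)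
      have e1 : (insert a (B ∪ R)).erase i ∪ (B ∪ R) = insert a (B ∪ R) := by
        ext x; simp only [Finset.mem_union, Finset.mem_erase, Finset.mem_insert]
        constructor
        · tauto
        · rintro (rfl | hx)
          · exact Or.inl ⟨hia.symm, Or.inl rfl⟩
          · exact Or.inr hx
      have e2 : (insert a (B ∪ R)).erase i ∩ (B ∪ R) = (B ∪ R).erase i := by
        ext x; simp only [Finset.mem_inter, Finset.mem_union, Finset.mem_erase, Finset.mem_insert]
        tauto
      rw [e1, e2] at h1
      linarith
    linarith

theorem IsSubmodular.le_sum_add (hG : IsSubmodular G) (h0 : G ∅ = 0) (A B : Finset α)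
    (h : Disjoint A B) : G (A ∪ B) ≤ G A + ∑ i ∈ B, G {i} := by
  induction B using Finset.induction_on with
  | empty => simp
  | insert a B ha ih =>
    rw [Finset.disjoint_insert_right] at h
    have haBR : a ∉ A ∪ B := by simp [h.1, ha]
    have h1 := hG {a} (A ∪ B)
    rw [Finset.singleton_inter_of_notMem haBR, ← Finset.insert_eq, h0] at h1
    rw [Finset.sum_insert ha, Finset.union_insert]
    linarith [ih h.2]

theorem IsSubmodular.le_sum (hG : IsSubmodular G) (h0 : G ∅ = 0) (B : Finset α) :
    G B ≤ ∑ i ∈ B, G {i} := by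
  simpa [h0] using hG.le_sum_add h0 ∅ B (by simp)

/-- The bound G(B) ≤ G(A) + Σ_{B \ A} G{i} leaves no room for a deficit on A when there is none on
B. -/
theorem IsSubmodular.eq_sum_of_subset (hG : IsSubmodular G) (h0 : G ∅ = 0) {A B : Finset α}
    (hAB : A ⊆ B) (hB : G B = ∑ i ∈ B, G {i}) : G A = ∑ i ∈ A, G {i} := by
  refine le_antisymm (hG.le_sum h0 A) ?_
  have h1 := hG.le_sum_add h0 A (B \ A) Finset.disjoint_sdiff
  rw [Finset.union_sdiff_of_subset hAB, hB, ← Finset.sum_sdiff hAB] at h1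
  linarith

theorem IsSubmodular.card_sub_one_mul_le (hG : IsSubmodular G) (h0 : G ∅ = 0) (S : Finset α) :
    ((S.card : ℝ) - 1) * G S ≤ ∑ i ∈ S, G (S.erase i) := by
  have h := hG.sum_sub_erase_le ∅ S (by simp)
  simp only [Finset.empty_union, Finset.sum_sub_distrib, Finset.sum_const, nsmul_eq_mul, h0] at h
  linarith

theorem IsSubmodular.eq_sum_of_sum_erase_le (hG : IsSubmodular G) (h0 : G ∅ = 0) (S : Finset α)
    (hS : ∑ i ∈ S, G (S.erase i) ≤ ((S.card : ℝ) - 1) * G S) : G S = ∑ i ∈ S, G {i} := by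
  have h := hG.sum_sub_erase_le ∅ S (by simp)
  simp only [Finset.empty_union, h0] at h
  have htot : G S ≤ ∑ i ∈ S, (G S - G (S.erase i)) := by
    simp only [Finset.sum_sub_distrib, Finset.sum_const, nsmul_eq_mul]
    linarith
  refine le_antisymm (hG.le_sum h0 S) ?_
  -- The top gains sum to at least G(S) by `htot`, while those other than that of j sum to at most
  -- G(S) - G{j} (telescoping from {j}). Hence the top gain of j is at least G{j}, although
  -- submodularity alone gives the reverse bound.
  have key : ∑ j ∈ S, G {j} ≤ ∑ j ∈ S, (G S - G (S.erase j)) := by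
    refine Finset.sum_le_sum fun j hj => ?_
    have h1 := hG.sum_sub_erase_le {j} (S.erase j) (by simp)
    rw [← Finset.insert_eq, Finset.insert_erase hj] at h1
    rw [← Finset.add_sum_erase _ _ hj] at htot
    linarith
  linarith

/-- Double counting: a k-subset R arises as S minus i once for each i in P \ R. -/
theorem sum_powersetCard_succ_erase (P : Finset α) (k : ℕ) (g : Finset α → ℝ) :
    ∑ S ∈ P.powersetCard (k + 1), ∑ i ∈ S, g (S.erase i) =
      ((P.card : ℝ) - k) * ∑ R ∈ P.powersetCard k, g R := by
  have h : ∑ S ∈ P.powersetCard (k + 1), ∑ i ∈ S, g (S.erase i) =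
      ∑ R ∈ P.powersetCard k, ∑ _i ∈ P \ R, g R := by
    rw [Finset.sum_sigma', Finset.sum_sigma']
    refine Finset.sum_bij' (fun x _ => ⟨x.1.erase x.2, x.2⟩) (fun x _ => ⟨insert x.2 x.1, x.2⟩)
      ?_ ?_ ?_ ?_ ?_
    · rintro ⟨S, i⟩ h
      simp only [Finset.mem_sigma, Finset.mem_powersetCard, Finset.mem_sdiff] at h ⊢
      refine ⟨⟨(Finset.erase_subset _ _).trans h.1.1, ?_⟩, h.1.1 h.2, by simp⟩
      rw [Finset.card_erase_of_mem h.2, h.1.2]; rfl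
    · rintro ⟨S, i⟩ h
      simp only [Finset.mem_sigma, Finset.mem_powersetCard, Finset.mem_sdiff] at h ⊢
      refine ⟨⟨Finset.insert_subset h.2.1 h.1.1, ?_⟩, by simp⟩
      rw [Finset.card_insert_of_notMem h.2.2, h.1.2]
    · rintro ⟨S, i⟩ h
      simp only [Finset.mem_sigma] at h
      simp [Finset.insert_erase h.2]
    · rintro ⟨S, i⟩ h
      simp only [Finset.mem_sigma, Finset.mem_sdiff] at h
      simp [Finset.erase_insert h.2.2]
    · rintro ⟨S, i⟩ _
      rfl
  rw [h, Finset.mul_sum]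
  refine Finset.sum_congr rfl fun R hR => ?_
  rw [Finset.mem_powersetCard] at hR
  rw [Finset.sum_const, nsmul_eq_mul, Finset.card_sdiff_of_subset hR.1,
    Nat.cast_sub (Finset.card_le_card hR.1), hR.2]

theorem IsSubmodular.mul_sum_powersetCard_succ_le (hG : IsSubmodular G) (h0 : G ∅ = 0)
    (P : Finset α) (k : ℕ) :
    (k : ℝ) * ∑ S ∈ P.powersetCard (k + 1), G S ≤
      ((P.card : ℝ) - k) * ∑ S ∈ P.powersetCard k, G S := by
  rw [← sum_powersetCard_succ_erase, Finset.mul_sum]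
  refine Finset.sum_le_sum fun S hS => ?_
  have := hG.card_sub_one_mul_le h0 S
  rw [(Finset.mem_powersetCard.1 hS).2] at this
  simpa using this

theorem IsSubmodular.eq_sum_of_mul_sum_powersetCard_le (hG : IsSubmodular G) (h0 : G ∅ = 0)
    (P : Finset α) (k : ℕ)
    (h : ((P.card : ℝ) - k) * ∑ S ∈ P.powersetCard k, G S ≤
      (k : ℝ) * ∑ S ∈ P.powersetCard (k + 1), G S)
    {S : Finset α} (hS : S ∈ P.powersetCard (k + 1)) : G S = ∑ i ∈ S, G {i} := by
  have hle : ∀ S ∈ P.powersetCard (k + 1), (k : ℝ) * G S ≤ ∑ i ∈ S, G (S.erase i) := by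
    intro S hS
    have := hG.card_sub_one_mul_le h0 S
    rw [(Finset.mem_powersetCard.1 hS).2] at this
    simpa using this
  rw [← sum_powersetCard_succ_erase, Finset.mul_sum] at h
  -- Equality between the sums makes each termwise inequality tight.
  have heq := (Finset.sum_eq_sum_iff_of_le hle).1 (le_antisymm (Finset.sum_le_sum hle) h) S hS
  refine hG.eq_sum_of_sum_erase_le h0 S ?_
  rw [(Finset.mem_powersetCard.1 hS).2, ← heq]
  simp

theorem sum_powersetCard_sum (P : Finset α) (k : ℕ) (c : α → ℝ) :
    ∑ S ∈ P.powersetCard (k + 1), ∑ i ∈ S, c i =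
      ((P.card - 1).choose k : ℝ) * ∑ i ∈ P, c i := by
  rw [Finset.sum_comm' (t' := P) (s' := fun i => (P.powersetCard (k + 1)).filter (i ∈ ·))]
  · rw [Finset.mul_sum]
    refine Finset.sum_congr rfl fun i hi => ?_
    rw [Finset.sum_const, nsmul_eq_mul]
    congr 2
    rw [← Finset.card_erase_of_mem hi, ← Finset.card_powersetCard]
    refine Finset.card_bij' (fun S _ => S.erase i) (fun S _ => insert i S) ?_ ?_ ?_ ?_
    · intro S hS
      simp only [Finset.mem_filter, Finset.mem_powersetCard] at hS ⊢
      refine ⟨Finset.erase_subset_erase _ hS.1.1, ?_⟩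
      rw [Finset.card_erase_of_mem hS.2, hS.1.2]; rfl
    · intro S hS
      simp only [Finset.mem_filter, Finset.mem_powersetCard] at hS ⊢
      have hiS : i ∉ S := fun h => by simpa using hS.1 h
      refine ⟨⟨Finset.insert_subset hi (hS.1.trans (Finset.erase_subset _ _)), ?_⟩, by simp⟩
      rw [Finset.card_insert_of_notMem hiS, hS.2]
    · intro S hS
      simp only [Finset.mem_filter] at hS
      exact Finset.insert_erase hS.2
    · intro S hS
      simp only [Finset.mem_powersetCard] at hS
      exact Finset.erase_insert fun h => by simpa using hS.1 h
  · intro S i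
    simp only [Finset.mem_powersetCard, Finset.mem_filter]
    exact ⟨fun h => ⟨h, h.1.1 h.2⟩, fun h => h.1⟩

/-- Han's inequality for a submodular set function, with the equality case. -/
theorem IsSubmodular.han (hG : IsSubmodular G) (h0 : G ∅ = 0) (P : Finset α) (m j : ℕ)
    (hj : P.card = m + 1 + j) :
    ((P.card - 1).choose m : ℝ) * G P ≤ ∑ S ∈ P.powersetCard (m + 1), G S ∧
    (j ≠ 0 → ∑ S ∈ P.powersetCard (m + 1), G S ≤ ((P.card - 1).choose m : ℝ) * G P →
      G P = ∑ i ∈ P, G {i}) := by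
  -- Here j is the distance from subset size m + 1 to the top size |P|, so the induction climbs to
  -- larger subsets. At j = 0 the only subset is P and equality carries no information, whence the
  -- condition j ≠ 0.
  induction j generalizing m with
  | zero =>
    have : m + 1 = P.card := by omega
    rw [this, Finset.powersetCard_self, show P.card - 1 = m by omega]
    simp
  | succ j ih =>
    obtain ⟨ih1, ih2⟩ := ih (m + 1) (by omega)
    have hstep := hG.mul_sum_powersetCard_succ_le h0 P (m + 1)
    have hstep' := fun h => hG.eq_sum_of_mul_sum_powersetCard_le h0 P (m + 1) h (S := P)
    have hch : ((P.card - 1).choose (m + 1) : ℝ) * ((m + 1 : ℕ) : ℝ) =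
        ((P.card - 1).choose m : ℝ) * ((P.card : ℝ) - (m + 1 : ℕ)) := by
      have := Nat.choose_succ_right_eq (P.card - 1) m
      have e : (P.card : ℝ) - (m + 1 : ℕ) = ((P.card - 1 - m : ℕ) : ℝ) := by
        rw [hj]; push_cast [show m + 1 + (j + 1) - 1 - m = j + 1 by omega]; ring
      rw [e]; exact_mod_cast this
    have hpos : (0 : ℝ) < (P.card : ℝ) - (m + 1 : ℕ) := by rw [hj]; push_cast; linarith
    have hm : (0 : ℝ) < ((m + 1 : ℕ) : ℝ) := by positivity
    set a := ∑ S ∈ P.powersetCard (m + 1), G S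
    set b := ∑ S ∈ P.powersetCard (m + 1 + 1), G S
    have h2 := mul_le_mul_of_nonneg_left ih1 hm.le
    have e2 : ((m + 1 : ℕ) : ℝ) * (((P.card - 1).choose (m + 1) : ℝ) * G P) =
        ((P.card : ℝ) - (m + 1 : ℕ)) * (((P.card - 1).choose m : ℝ) * G P) := by
      linear_combination G P * hch
    refine ⟨le_of_mul_le_mul_left (by linarith) hpos, fun _ h => ?_⟩
    have h3 := mul_le_mul_of_nonneg_left h hpos.le
    -- Equality passes up the sizes. At the last step the (m + 2)-subset is P itself, and tightness
    -- between adjacent sizes gives additivity there.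
    by_cases hj0 : j = 0
    · exact hstep' (by linarith) (by simp [hj, hj0])
    · exact ih2 hj0 (le_of_mul_le_mul_left (by linarith) hm)

/-- The average of the contractions over the `k`-subsets of `P`, plus `F L`. -/
noncomputable def condAverage (F : Finset α → ℝ) (k : ℕ) (P L : Finset α) : ℝ :=
  1 / ((P.card - 1).choose (k - 1) : ℝ) * ∑ S ∈ P.powersetCard k, contract F L S + F L

theorem IsSubmodular.le_condAverage (hF : IsSubmodular F) {k : ℕ} (hk : 1 ≤ k) (P L : Finset α)
    (hkP : k ≤ P.card) :
    F (P ∪ L) ≤ condAverage F k P L ∧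
    (k < P.card → (F (P ∪ L) = condAverage F k P L ↔
      HanEntropy.contract F L P = ∑ i ∈ P, HanEntropy.contract F L {i})) ∧
    (k = P.card → F (P ∪ L) = condAverage F k P L) := by
  obtain ⟨m, rfl⟩ : ∃ m, k = m + 1 := ⟨k - 1, by omega⟩
  obtain ⟨j, hj⟩ := Nat.exists_eq_add_of_le hkP
  have h0 := contract_empty (F := F) L
  obtain ⟨h1, h2⟩ := (hF.contract L).han h0 P m j hj
  have hc : (0 : ℝ) < ((P.card - 1).choose m : ℝ) := by
    exact_mod_cast Nat.choose_pos (by omega)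
  have hP : F (P ∪ L) = HanEntropy.contract F L P + F L := by simp [HanEntropy.contract]
  unfold condAverage
  rw [hP, Nat.add_sub_cancel]
  refine ⟨?_, fun hlt => ⟨fun h => ?_, fun h => ?_⟩, fun he => ?_⟩
  · rw [one_div, add_le_add_iff_right, inv_mul_eq_div, le_div_iff₀ hc, mul_comm]
    exact h1
  · rw [add_left_inj, one_div, inv_mul_eq_div, eq_div_iff hc.ne'] at h
    exact h2 (by omega) (by linarith)
  · rw [add_left_inj, one_div, inv_mul_eq_div, eq_div_iff hc.ne', h, mul_comm,
      ← sum_powersetCard_sum]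
    exact Finset.sum_congr rfl fun S hS => ((hF.contract L).eq_sum_of_subset h0
      (Finset.mem_powersetCard.1 hS).1 h).symm
  · rw [he, Finset.powersetCard_self, show P.card - 1 = m by omega]
    simp

/-- One move of a into the ground set, with both binomial denominators cleared. Subsets of `insert a
P` avoiding a lose value when contracted by a. Those containing a contribute G{a} plus the
contraction on m-subsets, which is compared with (m + 1)-subsets by the adjacent-size inequality. -/
theorem IsSubmodular.insert_step (hG : IsSubmodular G) (h0 : G ∅ = 0) (P : Finset α) {a : α}
    (ha : a ∉ P) (m : ℕ) (hm : m + 1 ≤ P.card) :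
    (P.card.choose m : ℝ) * (∑ S ∈ P.powersetCard (m + 1), (G (insert a S) - G {a})) +
        ((P.card - 1).choose m : ℝ) * ((P.card.choose m : ℝ) * G {a}) ≤
      ((P.card - 1).choose m : ℝ) * ∑ T ∈ (insert a P).powersetCard (m + 1), G T ∧
    (((P.card - 1).choose m : ℝ) * ∑ T ∈ (insert a P).powersetCard (m + 1), G T ≤
      (P.card.choose m : ℝ) * (∑ S ∈ P.powersetCard (m + 1), (G (insert a S) - G {a})) +
        ((P.card - 1).choose m : ℝ) * ((P.card.choose m : ℝ) * G {a}) →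
      ∀ S ∈ P.powersetCard (m + 1), G (insert a S) = ∑ i ∈ insert a S, G {i}) := by
  have hG' := hG.contract {a}
  have h0' := contract_empty (F := G) {a}
  have hc (S : Finset α) : HanEntropy.contract G {a} S = G (insert a S) - G {a} := by
    rw [HanEntropy.contract, Finset.union_comm, ← Finset.insert_eq]
  have hsplit : ∑ T ∈ (insert a P).powersetCard (m + 1), G T =
      ∑ S ∈ P.powersetCard (m + 1), G S + (∑ S ∈ P.powersetCard m, HanEntropy.contract G {a} S +
        (P.card.choose m : ℝ) * G {a}) := by
    rw [Finset.powersetCard_succ_insert ha, Finset.sum_union, Finset.sum_image]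
    · simp only [hc, Finset.sum_sub_distrib, Finset.sum_const, nsmul_eq_mul,
        Finset.card_powersetCard]
      ring
    · intro S hS T hT hST
      have h1 : a ∉ S := fun h => ha ((Finset.mem_powersetCard.1 hS).1 h)
      have h2 : a ∉ T := fun h => ha ((Finset.mem_powersetCard.1 hT).1 h)
      rw [← Finset.erase_insert h1, hST, Finset.erase_insert h2]
    · rw [Finset.disjoint_left]
      intro S hS hS'
      obtain ⟨T, -, rfl⟩ := Finset.mem_image.1 hS'
      exact ha ((Finset.mem_powersetCard.1 hS).1 (Finset.mem_insert_self _ _))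
  have hle : ∀ S ∈ P.powersetCard (m + 1), HanEntropy.contract G {a} S ≤ G S := by
    intro S hS
    have h1 : a ∉ S := fun h => ha ((Finset.mem_powersetCard.1 hS).1 h)
    have := hG {a} S
    rw [Finset.singleton_inter_of_notMem h1, ← Finset.insert_eq, h0] at this
    rw [hc]; linarith
  have hsum := Finset.sum_le_sum hle
  have hstep := hG'.mul_sum_powersetCard_succ_le h0' P m
  have hpos : (0 : ℝ) < (P.card : ℝ) - m := by
    have : ((m + 1 : ℕ) : ℝ) ≤ P.card := by exact_mod_cast hm
    push_cast at this; linarith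
  have hC : (0 : ℝ) < ((P.card - 1).choose m : ℝ) := by
    exact_mod_cast Nat.choose_pos (by omega)
  have hch : (P.card.choose m : ℝ) * ((P.card : ℝ) - m) = ((P.card - 1).choose m : ℝ) * P.card := by
    obtain ⟨r, hr⟩ : ∃ r, P.card = r + 1 := ⟨P.card - 1, by omega⟩
    have := Nat.choose_mul_succ_eq r m
    rw [hr, Nat.add_sub_cancel, ← Nat.cast_sub (by omega)]
    exact_mod_cast this.symm
  rw [hsplit]
  simp only [← hc]
  set A' := ∑ S ∈ P.powersetCard (m + 1), HanEntropy.contract G {a} S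
  set A := ∑ S ∈ P.powersetCard (m + 1), G S
  set B := ∑ S ∈ P.powersetCard m, HanEntropy.contract G {a} S
  set C := ((P.card - 1).choose m : ℝ)
  set D := (P.card.choose m : ℝ)
  set q : ℝ := (P.card : ℝ) - m
  -- The total slack, up to positive factors, is the sum of two nonnegative slacks: contracting by
  -- a, and passing between adjacent sizes. Equality therefore kills both.
  have hid : q * (C * (A + (B + D * G {a})) - (D * A' + C * (D * G {a}))) =
      C * (q * (A - A') + (q * B - m * A')) := by
    have : q * (D * A') = C * (m + q) * A' := by
      rw [show (m : ℝ) + q = P.card by simp [q]]; linear_combination A' * hch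
    linear_combination - this
  have hA : 0 ≤ q * (A - A') := mul_nonneg hpos.le (by linarith)
  constructor
  · have : 0 ≤ q * (C * (A + (B + D * G {a})) - (D * A' + C * (D * G {a}))) := by
      rw [hid]; exact mul_nonneg hC.le (by linarith)
    have := nonneg_of_mul_nonneg_right this hpos
    linarith
  · intro h S hS
    have h1 : C * (q * (A - A') + (q * B - m * A')) ≤ 0 := by
      rw [← hid]; exact mul_nonpos_of_nonneg_of_nonpos hpos.le (by linarith)
    have h2 : q * (A - A') + (q * B - m * A') ≤ 0 := by
      by_contra hcon
      exact absurd h1 (not_le.2 (mul_pos hC (not_le.1 hcon)))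
    have h3 : A' = A := by
      have : q * (A - A') ≤ 0 := by linarith
      have : A - A' ≤ 0 := by
        by_contra hcon
        exact absurd this (not_le.2 (mul_pos hpos (not_le.1 hcon)))
      linarith
    have h4 := hG'.eq_sum_of_mul_sum_powersetCard_le h0' P m (by linarith) hS
    have h5 := (Finset.sum_eq_sum_iff_of_le hle).1 h3 S hS
    have haS : a ∉ S := fun h => ha ((Finset.mem_powersetCard.1 hS).1 h)
    -- By `h5` the gain of a over S is the full G{a}. The gain over the smaller set {i} lies between
    -- this and G{a}, so it is G{a} too.
    have h6 : ∑ i ∈ S, HanEntropy.contract G {a} {i} = ∑ i ∈ S, G {i} := by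
      refine Finset.sum_congr rfl fun i hi => ?_
      have hia : a ∉ ({i} : Finset α) := by
        rw [Finset.mem_singleton]; rintro rfl; exact haS hi
      have h1 := hG {a} {i}
      rw [Finset.singleton_inter_of_notMem hia, ← Finset.insert_eq, h0] at h1
      have h2 := hG (insert a {i}) S
      rw [Finset.insert_union, ← Finset.insert_eq, Finset.insert_eq_of_mem hi,
        Finset.insert_inter_of_notMem haS, Finset.singleton_inter_of_mem hi] at h2
      rw [hc] at h5 ⊢
      linarith
    rw [Finset.sum_insert haS, ← h6, ← h4, hc]; ring

theorem IsSubmodular.condAverage_insert (hF : IsSubmodular F) {k : ℕ} (hk : 1 ≤ k)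
    (P L : Finset α) (hkP : k ≤ P.card) {a : α} (ha : a ∉ P) :
    condAverage F k P (insert a L) ≤ condAverage F k (insert a P) L ∧
    (condAverage F k P (insert a L) = condAverage F k (insert a P) L →
      ∀ S ∈ P.powersetCard k, HanEntropy.contract F L (insert a S) =
        ∑ i ∈ insert a S, HanEntropy.contract F L {i}) := by
  obtain ⟨m, rfl⟩ : ∃ m, k = m + 1 := ⟨k - 1, by omega⟩
  obtain ⟨h1, h2⟩ := (hF.contract L).insert_step (contract_empty (F := F) L) P ha m hkP
  have hc (S : Finset α) : HanEntropy.contract F (insert a L) S =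
      HanEntropy.contract F L (insert a S) - HanEntropy.contract F L {a} := by
    simp only [HanEntropy.contract, Finset.union_insert, Finset.insert_union, ← Finset.insert_eq]
    ring
  have hL : F (insert a L) = HanEntropy.contract F L {a} + F L := by
    simp [HanEntropy.contract]
  have hC : (0 : ℝ) < ((P.card - 1).choose m : ℝ) := by
    exact_mod_cast Nat.choose_pos (by omega)
  have hD : (0 : ℝ) < (P.card.choose m : ℝ) := by
    exact_mod_cast Nat.choose_pos (by omega)
  simp only [condAverage, Finset.card_insert_of_notMem ha, Nat.add_sub_cancel, hL, hc]
  set A := ∑ S ∈ P.powersetCard (m + 1),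
    (HanEntropy.contract F L (insert a S) - HanEntropy.contract F L {a})
  set B := ∑ S ∈ (insert a P).powersetCard (m + 1), HanEntropy.contract F L S
  set C := ((P.card - 1).choose m : ℝ)
  set D := (P.card.choose m : ℝ)
  set g := HanEntropy.contract F L {a}
  have e : C * B - (D * A + C * (D * g)) =
      C * D * (1 / D * B + F L - (1 / C * A + (g + F L))) := by
    field_simp
    ring
  constructor
  · have : 0 ≤ C * D * (1 / D * B + F L - (1 / C * A + (g + F L))) := by rw [← e]; linarith
    have := nonneg_of_mul_nonneg_right this (mul_pos hC hD)
    linarith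
  · intro h
    rw [h, sub_self, mul_zero] at e
    exact h2 (by linarith)

/-- The conditional averages increase when elements are moved from the conditioning set into
the ground set. -/
theorem IsSubmodular.condAverage_le (hF : IsSubmodular F) (h0 : F ∅ = 0) {k : ℕ} (hk : 1 ≤ k)
    (P L : Finset α) (hkP : k ≤ P.card) (hPL : Disjoint P L) :
    condAverage F k P L ≤ condAverage F k (P ∪ L) ∅ ∧
    (L.Nonempty → condAverage F k P L = condAverage F k (P ∪ L) ∅ →
      ∀ S ∈ P.powersetCard k, F (S ∪ L) = ∑ i ∈ S ∪ L, F {i}) := by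
  induction L using Finset.induction_on generalizing P with
  | empty => simp
  | insert a L ha ih =>
    rw [Finset.disjoint_insert_right] at hPL
    obtain ⟨haP, hd⟩ := hPL
    obtain ⟨h1, h2⟩ := hF.condAverage_insert hk P L hkP haP
    obtain ⟨i1, i2⟩ := ih (insert a P) (by rw [Finset.card_insert_of_notMem haP]; omega)
      (by rw [Finset.disjoint_insert_left]; exact ⟨ha, hd⟩)
    rw [Finset.insert_union, ← Finset.union_insert] at i1 i2
    refine ⟨h1.trans i1, fun _ h S hS => ?_⟩
    have hstep := h2 (le_antisymm h1 (h ▸ i1)) S hS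
    have hIH := fun hL => i2 hL (le_antisymm i1 (h ▸ h1))
    have hSP := (Finset.mem_powersetCard.1 hS).1
    have haS : a ∉ S := fun h => haP (hSP h)
    -- The induction hypothesis concerns k-subsets, but `insert a S` has k + 1 elements. Each of its
    -- elements is covered separately; a is swapped in for some b in S.
    have hsub : ∀ i ∈ insert a S, ∃ T ∈ (insert a P).powersetCard k, i ∈ T := by
      intro i hi
      rcases Finset.mem_insert.1 hi with rfl | hi
      · obtain ⟨b, hb⟩ : S.Nonempty := by
          rw [← Finset.card_pos, (Finset.mem_powersetCard.1 hS).2]; omega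
        refine ⟨insert i (S.erase b), ?_, by simp⟩
        rw [Finset.mem_powersetCard, Finset.card_insert_of_notMem (by simp [haS]),
          Finset.card_erase_of_mem hb, (Finset.mem_powersetCard.1 hS).2]
        exact ⟨Finset.insert_subset_insert _ ((Finset.erase_subset _ _).trans hSP), by omega⟩
      · exact ⟨S, Finset.powersetCard_mono (Finset.subset_insert _ _) hS, hi⟩
    have hdS : Disjoint (insert a S) L := by
      rw [Finset.disjoint_insert_left]; exact ⟨ha, Finset.disjoint_of_subset_left hSP hd⟩
    have hLi : F L = ∑ i ∈ L, F {i} := by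
      rcases L.eq_empty_or_nonempty with rfl | hL
      · simpa using h0
      · exact hF.eq_sum_of_subset h0 Finset.subset_union_right
          (hIH hL S (Finset.powersetCard_mono (Finset.subset_insert _ _) hS))
    have hi : ∀ i ∈ insert a S, HanEntropy.contract F L {i} = F {i} := by
      intro i hi
      have hiL : i ∉ L := fun h => Finset.disjoint_left.1 hdS hi h
      rcases L.eq_empty_or_nonempty with rfl | hL
      · simp [HanEntropy.contract, h0]
      · obtain ⟨T, hT, hiT⟩ := hsub i hi
        have := hF.eq_sum_of_subset h0 (Finset.union_subset_union_left
          (Finset.singleton_subset_iff.2 hiT)) (hIH hL T hT)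
        rw [HanEntropy.contract, this, hLi, ← Finset.insert_eq, Finset.sum_insert hiL]
        ring
    rw [Finset.sum_congr rfl hi, HanEntropy.contract, hLi, sub_eq_iff_eq_add,
      ← Finset.sum_union hdS] at hstep
    rwa [Finset.union_insert, ← Finset.insert_union]

theorem condAverage_eq_sum {k : ℕ} (hk : 1 ≤ k)
    (P L : Finset α) (hkP : k ≤ P.card) (hPL : Disjoint P L) (hL : F L = ∑ i ∈ L, F {i})
    (h : ∀ S ∈ P.powersetCard k, F (S ∪ L) = ∑ i ∈ S ∪ L, F {i}) :
    condAverage F k P L = ∑ i ∈ P ∪ L, F {i} := by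
  obtain ⟨m, rfl⟩ : ∃ m, k = m + 1 := ⟨k - 1, by omega⟩
  have hC : (0 : ℝ) < ((P.card - 1).choose m : ℝ) := by
    exact_mod_cast Nat.choose_pos (by omega)
  have hs : ∑ S ∈ P.powersetCard (m + 1), HanEntropy.contract F L S =
      ∑ S ∈ P.powersetCard (m + 1), ∑ i ∈ S, F {i} := by
    refine Finset.sum_congr rfl fun S hS => ?_
    rw [HanEntropy.contract, h S hS, hL, Finset.sum_union (Finset.disjoint_of_subset_left
      (Finset.mem_powersetCard.1 hS).1 hPL)]
    ring
  rw [condAverage, hs, sum_powersetCard_sum, Nat.add_sub_cancel, hL, Finset.sum_union hPL]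
  field_simp

theorem IsSubmodular.condAverage_eq_iff (hF : IsSubmodular F) (h0 : F ∅ = 0) {k : ℕ} (hk : 1 ≤ k)
    (P L : Finset α) (hkP : k ≤ P.card) (hPL : Disjoint P L) (hL : L.Nonempty) :
    condAverage F k P L = condAverage F k (P ∪ L) ∅ ↔
      ∀ S ∈ P.powersetCard k, F (S ∪ L) = ∑ i ∈ S ∪ L, F {i} := by
  refine ⟨(hF.condAverage_le h0 hk P L hkP hPL).2 hL, fun h => ?_⟩
  obtain ⟨S₀, hS₀⟩ := Finset.powersetCard_nonempty.2 hkP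
  have hL' := hF.eq_sum_of_subset h0 Finset.subset_union_right (h S₀ hS₀)
  refine le_antisymm (hF.condAverage_le h0 hk P L hkP hPL).1 ?_
  -- The smaller average is now the sum of all singleton values, and subadditivity bounds the larger
  -- average by that same sum.
  rw [condAverage_eq_sum hk P L hkP hPL hL' h]
  have hcard : k ≤ (P ∪ L).card := hkP.trans (Finset.card_le_card Finset.subset_union_left)
  obtain ⟨m, rfl⟩ : ∃ m, k = m + 1 := ⟨k - 1, by omega⟩
  have hC : (0 : ℝ) < (((P ∪ L).card - 1).choose m : ℝ) := by
    exact_mod_cast Nat.choose_pos (by omega)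
  rw [condAverage, h0, add_zero, Nat.add_sub_cancel, one_div, inv_mul_eq_div, div_le_iff₀ hC,
    mul_comm, ← sum_powersetCard_sum]
  refine Finset.sum_le_sum fun T _ => ?_
  simpa [HanEntropy.contract, h0] using hF.le_sum h0 T

/-- The excess of a contraction over the sum of its values vanishes iff each element can be
split off from each subset. -/
theorem IsSubmodular.contract_eq_sum_iff (hF : IsSubmodular F) (P L : Finset α) :
    HanEntropy.contract F L P = ∑ i ∈ P, HanEntropy.contract F L {i} ↔
      ∀ R ⊆ P, ∀ i ∈ P, i ∉ R →
        F ({i} ∪ (R ∪ L)) + F L = F ({i} ∪ L) + F (R ∪ L) := by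
  have h0 := contract_empty (F := F) L
  constructor
  · intro h R hR i hi hiR
    have h1 := (hF.contract L).eq_sum_of_subset h0 (Finset.insert_subset hi hR) h
    have h2 := (hF.contract L).eq_sum_of_subset h0 hR h
    rw [Finset.sum_insert hiR, ← h2] at h1
    simp only [HanEntropy.contract, Finset.insert_eq, Finset.union_assoc] at h1 ⊢
    linarith
  · intro h
    have key : ∀ R ⊆ P, HanEntropy.contract F L R = ∑ i ∈ R, HanEntropy.contract F L {i} := by
      intro R
      induction R using Finset.induction_on with
      | empty => intro; simp [h0]
      | insert a R ha ih =>
        intro hR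
        rw [Finset.insert_subset_iff] at hR
        have := h R hR.2 a hR.1 ha
        rw [Finset.sum_insert ha, ← ih hR.2]
        simp only [HanEntropy.contract, Finset.insert_eq, Finset.union_assoc] at this ⊢
        linarith
    exact key P subset_rfl

end Submodular

end HanEntropy

namespace HanEntropy

/-! ### Conditional independence expressed through densities. -/

section ConditionalProduct

open scoped ENNReal

variable {Ω E₁ E₂ E₃ : Type*} [MeasurableSpace Ω] [MeasurableSpace E₁] [MeasurableSpace E₂]
  [MeasurableSpace E₃] {μ : Measure Ω} {W : Ω → E₁} {Y : Ω → E₂} {Z : Ω → E₃}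
  {lW : Measure E₁} {lY : Measure E₂} {lZ : Measure E₃}

/-- A version of a conditional probability given `W` is characterised by its integrals over the
events `W ∈ C`. -/
theorem condExp_indicator_ae_eq_iff [IsProbabilityMeasure μ] (hW : Measurable W) {s : Set Ω}
    (hs : MeasurableSet s) {g : E₁ → ℝ≥0∞} (hg : Measurable g) (hg1 : ∀ᵐ ω ∂μ, g (W ω) ≤ 1) :
    μ⟦s | MeasurableSpace.comap W inferInstance⟧ =ᵐ[μ] (fun ω => (g (W ω)).toReal) ↔
      ∀ C, MeasurableSet C → ∫⁻ ω in W ⁻¹' C, g (W ω) ∂μ = μ (W ⁻¹' C ∩ s) := by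
  have hm : MeasurableSpace.comap W inferInstance ≤ (inferInstance : MeasurableSpace Ω) :=
    hW.comap_le
  have hint : Integrable (s.indicator fun _ => (1 : ℝ)) μ :=
    (integrable_const (1 : ℝ)).indicator hs
  have hgint : Integrable (fun ω => (g (W ω)).toReal) μ := by
    refine Integrable.of_bound (hg.comp hW).ennreal_toReal.aestronglyMeasurable 1 ?_
    filter_upwards [hg1] with ω h
    rw [Real.norm_of_nonneg ENNReal.toReal_nonneg]
    exact ENNReal.toReal_le_of_le_ofReal zero_le_one (by simpa using h)
  have hgI : ∀ C, ∫ ω in W ⁻¹' C, (g (W ω)).toReal ∂μ =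
      (∫⁻ ω in W ⁻¹' C, g (W ω) ∂μ).toReal := fun C =>
    integral_toReal (hg.comp hW).aemeasurable
      (ae_restrict_of_ae (hg1.mono fun ω h => h.trans_lt ENNReal.one_lt_top))
  have hgtop : ∀ C, ∫⁻ ω in W ⁻¹' C, g (W ω) ∂μ ≠ ∞ := fun C => by
    refine ne_top_of_le_ne_top (measure_ne_top μ (W ⁻¹' C)) ?_
    refine (lintegral_mono_ae (ae_restrict_of_ae hg1)).trans ?_
    simp
  have hsI : ∀ C, MeasurableSet C →
      ∫ ω in W ⁻¹' C, s.indicator (fun _ => (1 : ℝ)) ω ∂μ = (μ (W ⁻¹' C ∩ s)).toReal := by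
    intro C hC
    rw [integral_indicator hs, Measure.restrict_restrict hs, Set.inter_comm]
    simp [Measure.real]
  constructor
  · intro h C hC
    have h1 : ∫ ω in W ⁻¹' C, (g (W ω)).toReal ∂μ = (μ (W ⁻¹' C ∩ s)).toReal := by
      rw [← hsI C hC, ← setIntegral_condExp hm hint ⟨C, hC, rfl⟩]
      exact integral_congr_ae (ae_restrict_of_ae h.symm)
    rw [hgI] at h1
    exact (ENNReal.toReal_eq_toReal_iff' (hgtop C) (measure_ne_top _ _)).1 h1
  · intro h
    refine (ae_eq_condExp_of_forall_setIntegral_eq hm hint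
      (fun _ _ _ => hgint.integrableOn) ?_ ?_).symm
    · rintro _ ⟨C, hC, rfl⟩ -
      rw [hgI, h C hC, hsI C hC]
    · refine (Measurable.stronglyMeasurable ?_).aestronglyMeasurable
      exact (hg.comp (comap_measurable W)).ennreal_toReal

theorem setLIntegral_setLIntegral_pdf [SFinite lY] (hW : Measurable W) (hY : Measurable Y)
    [HasPDF (fun ω => (W ω, Y ω)) μ (lW.prod lY)] [SFinite lW]
    {C : Set E₁} {B : Set E₂} (hC : MeasurableSet C) (hB : MeasurableSet B) :
    ∫⁻ w in C, ∫⁻ y in B, pdf (fun ω => (W ω, Y ω)) μ (lW.prod lY) (w, y) ∂lY ∂lW =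
      μ (W ⁻¹' C ∩ Y ⁻¹' B) := by
  rw [← lintegral_prod _ (measurable_pdf _ _ _).aemeasurable, Measure.prod_restrict,
    ← map_eq_setLIntegral_pdf _ _ _ (hC.prod hB), Measure.map_apply (hW.prodMk hY) (hC.prod hB)]
  rfl

theorem measurable_setLIntegral_pdf [SFinite lY] (B : Set E₂) :
    Measurable fun w => ∫⁻ y in B, pdf (fun ω => (W ω, Y ω)) μ (lW.prod lY) (w, y) ∂lY :=
  (measurable_pdf _ _ _).lintegral_prod_right'

/-- Both sides are compared after integration over W ∈ C, where they become P(W ∈ C, Y ∈ B) ≤ P(W ∈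
C). In particular the left side vanishes almost everywhere that f_W does, which makes division by
f_W harmless. -/
theorem setLIntegral_pdf_ae_le [IsProbabilityMeasure μ] [SigmaFinite lY] [SigmaFinite lW]
    (hW : Measurable W) (hY : Measurable Y) [HasPDF W μ lW]
    [HasPDF (fun ω => (W ω, Y ω)) μ (lW.prod lY)] {B : Set E₂} (hB : MeasurableSet B) :
    ∀ᵐ w ∂lW, ∫⁻ y in B, pdf (fun ω => (W ω, Y ω)) μ (lW.prod lY) (w, y) ∂lY ≤ pdf W μ lW w := by
  refine ae_le_of_forall_setLIntegral_le_of_sigmaFinite (measurable_setLIntegral_pdf B) ?_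
  intro C hC _
  rw [setLIntegral_setLIntegral_pdf hW hY hC hB, ← map_eq_setLIntegral_pdf _ _ _ hC,
    Measure.map_apply hW hC]
  exact measure_mono Set.inter_subset_left

/-- The conditional probability of `Y ∈ B` given `W = w`, computed from the densities. -/
noncomputable def condMass (μ : Measure Ω) (W : Ω → E₁) (Y : Ω → E₂) (lW : Measure E₁)
    (lY : Measure E₂) (B : Set E₂) (w : E₁) : ℝ≥0∞ :=
  (∫⁻ y in B, pdf (fun ω => (W ω, Y ω)) μ (lW.prod lY) (w, y) ∂lY) / pdf W μ lW w

theorem measurable_condMass [SFinite lY] (B : Set E₂) : Measurable (condMass μ W Y lW lY B) :=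
  (measurable_setLIntegral_pdf B).div (measurable_pdf _ _ _)

theorem condMass_ae_le_one [IsProbabilityMeasure μ] [SigmaFinite lY] [SigmaFinite lW]
    (hW : Measurable W) (hY : Measurable Y) [HasPDF W μ lW]
    [HasPDF (fun ω => (W ω, Y ω)) μ (lW.prod lY)] {B : Set E₂} (hB : MeasurableSet B) :
    ∀ᵐ ω ∂μ, condMass μ W Y lW lY B (W ω) ≤ 1 := by
  have h := setLIntegral_pdf_ae_le (μ := μ) (lW := lW) (lY := lY) hW hY hB
  filter_upwards [ae_of_ae_map hW.aemeasurable (HasPDF.absolutelyContinuous.ae_le h)] with ω h1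
  exact ENNReal.div_le_of_le_mul (by simpa using h1)

theorem pdf_mul_condMass [IsProbabilityMeasure μ] [SigmaFinite lY] [SigmaFinite lW]
    (hW : Measurable W) (hY : Measurable Y) [HasPDF W μ lW]
    [HasPDF (fun ω => (W ω, Y ω)) μ (lW.prod lY)] {B : Set E₂} (hB : MeasurableSet B) :
    ∀ᵐ w ∂lW, pdf W μ lW w * condMass μ W Y lW lY B w =
      ∫⁻ y in B, pdf (fun ω => (W ω, Y ω)) μ (lW.prod lY) (w, y) ∂lY := by
  filter_upwards [setLIntegral_pdf_ae_le (μ := μ) (lW := lW) (lY := lY) hW hY hB,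
    @pdf.ae_lt_top _ _ _ _ μ _ lW W] with w h1 h2
  refine ENNReal.mul_div_cancel' (fun h0 => ?_) fun h => absurd h h2.ne
  exact le_antisymm (h0 ▸ h1) zero_le

theorem setLIntegral_comp_eq [IsProbabilityMeasure μ] (hW : Measurable W) [HasPDF W μ lW]
    {g : E₁ → ℝ≥0∞} (hg : Measurable g) {C : Set E₁} (hC : MeasurableSet C) :
    ∫⁻ ω in W ⁻¹' C, g (W ω) ∂μ = ∫⁻ w in C, pdf W μ lW w * g w ∂lW := by
  rw [← setLIntegral_map hC hg hW, map_eq_withDensity_pdf W μ lW,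
    setLIntegral_withDensity_eq_setLIntegral_mul _ (measurable_pdf _ _ _) hg hC]
  rfl

theorem condExp_ae_eq_condMass [IsProbabilityMeasure μ] [SigmaFinite lY] [SigmaFinite lW]
    (hW : Measurable W) (hY : Measurable Y) [HasPDF W μ lW]
    [HasPDF (fun ω => (W ω, Y ω)) μ (lW.prod lY)] {B : Set E₂} (hB : MeasurableSet B) :
    μ⟦Y ⁻¹' B | MeasurableSpace.comap W inferInstance⟧ =ᵐ[μ]
      fun ω => (condMass μ W Y lW lY B (W ω)).toReal := by
  rw [condExp_indicator_ae_eq_iff hW (hY hB) (measurable_condMass B)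
    (condMass_ae_le_one hW hY hB)]
  intro C hC
  rw [setLIntegral_comp_eq (lW := lW) hW (measurable_condMass B) hC,
    ← setLIntegral_setLIntegral_pdf (lW := lW) (lY := lY) hW hY hC hB]
  exact lintegral_congr_ae (ae_restrict_of_ae (pdf_mul_condMass hW hY hB))

/-- The density which makes `Y` and `Z` conditionally independent given `W`, with the joint laws
of `(W, Y)` and `(W, Z)` unchanged. -/
noncomputable def condProdDensity (μ : Measure Ω) (W : Ω → E₁) (Y : Ω → E₂) (Z : Ω → E₃)
    (lW : Measure E₁) (lY : Measure E₂) (lZ : Measure E₃) (x : E₁ × E₂ × E₃) : ℝ≥0∞ :=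
  (pdf W μ lW x.1)⁻¹ * (pdf (fun ω => (W ω, Y ω)) μ (lW.prod lY) (x.1, x.2.1) *
    pdf (fun ω => (W ω, Z ω)) μ (lW.prod lZ) (x.1, x.2.2))

theorem measurable_condProdDensity : Measurable (condProdDensity μ W Y Z lW lY lZ) := by
  have h1 := measurable_pdf W μ lW
  have h2 := measurable_pdf (fun ω => (W ω, Y ω)) μ (lW.prod lY)
  have h3 := measurable_pdf (fun ω => (W ω, Z ω)) μ (lW.prod lZ)
  unfold condProdDensity
  fun_prop

theorem setLIntegral_condProdDensity [SFinite lW] [SFinite lY] [SFinite lZ]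
    (C : Set E₁) (B : Set E₂) (A : Set E₃) :
    ∫⁻ x in C ×ˢ B ×ˢ A, condProdDensity μ W Y Z lW lY lZ x ∂(lW.prod (lY.prod lZ)) =
      ∫⁻ w in C, (pdf W μ lW w)⁻¹ *
        ((∫⁻ y in B, pdf (fun ω => (W ω, Y ω)) μ (lW.prod lY) (w, y) ∂lY) *
          ∫⁻ z in A, pdf (fun ω => (W ω, Z ω)) μ (lW.prod lZ) (w, z) ∂lZ) ∂lW := by
  have h2 := measurable_pdf (fun ω => (W ω, Y ω)) μ (lW.prod lY)
  have h3 := measurable_pdf (fun ω => (W ω, Z ω)) μ (lW.prod lZ)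
  rw [← Measure.prod_restrict, lintegral_prod _ measurable_condProdDensity.aemeasurable]
  refine lintegral_congr fun w => ?_
  simp only [condProdDensity]
  rw [lintegral_const_mul _ (by fun_prop), ← Measure.prod_restrict]
  congr 1
  exact lintegral_prod_mul (f := fun y => pdf (fun ω => (W ω, Y ω)) μ (lW.prod lY) (w, y))
    (g := fun z => pdf (fun ω => (W ω, Z ω)) μ (lW.prod lZ) (w, z))
    (by fun_prop) (by fun_prop)

variable [IsProbabilityMeasure μ] [SigmaFinite lW] [SigmaFinite lY] [SigmaFinite lZ]
  [HasPDF W μ lW] [HasPDF (fun ω => (W ω, Y ω)) μ (lW.prod lY)]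

theorem setLIntegral_condProdDensity_eq (hW : Measurable W) (hY : Measurable Y)
    {C : Set E₁} {B : Set E₂} (hC : MeasurableSet C)
    (hB : MeasurableSet B) (A : Set E₃) :
    ∫⁻ x in C ×ˢ B ×ˢ A, condProdDensity μ W Y Z lW lY lZ x ∂(lW.prod (lY.prod lZ)) =
      ∫⁻ ω in W ⁻¹' C, condMass μ W Y lW lY B (W ω) * condMass μ W Z lW lZ A (W ω) ∂μ := by
  rw [setLIntegral_condProdDensity, setLIntegral_comp_eq (lW := lW) hW
    (g := fun w => condMass μ W Y lW lY B w * condMass μ W Z lW lZ A w)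
    ((measurable_condMass B).mul (measurable_condMass A)) hC]
  refine lintegral_congr_ae (ae_restrict_of_ae ?_)
  -- Cancelling f_W against the mass of Y suffices; the remaining factor f_W⁻¹ belongs to the mass
  -- of Z by definition.
  filter_upwards [pdf_mul_condMass (μ := μ) (lW := lW) (lY := lY) hW hY hB] with w h1
  rw [← mul_assoc (pdf W μ lW w), h1]
  simp only [condMass, div_eq_mul_inv]
  ring

variable [HasPDF (fun ω => (W ω, Z ω)) μ (lW.prod lZ)]

theorem lintegral_condProdDensity_le (hW : Measurable W) (hY : Measurable Y)
    (hZ : Measurable Z) :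
    ∫⁻ x, condProdDensity μ W Y Z lW lY lZ x ∂(lW.prod (lY.prod lZ)) ≤ 1 := by
  have h := setLIntegral_condProdDensity_eq (μ := μ) (lW := lW) (lY := lY) (lZ := lZ) (Z := Z) hW hY
    MeasurableSet.univ MeasurableSet.univ Set.univ
  simp only [Set.univ_prod_univ, Measure.restrict_univ, Set.preimage_univ] at h
  rw [h]
  calc _ ≤ ∫⁻ _, 1 ∂μ := by
        refine lintegral_mono_ae ?_
        filter_upwards [condMass_ae_le_one (μ := μ) (lW := lW) (lY := lY) hW hY MeasurableSet.univ,
          condMass_ae_le_one (μ := μ) (lW := lW) (lY := lZ) hW hZ MeasurableSet.univ] with ω h1 h2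
        exact mul_le_one' h1 h2
    _ = 1 := by simp

/-- The product of the two conditional masses is a candidate version of the conditional probability.
Testing it on events W ∈ C gives exactly the equality of the two measures on boxes. -/
theorem condExp_inter_ae_eq_mul_iff (hW : Measurable W) (hY : Measurable Y)
    (hZ : Measurable Z) {B : Set E₂} {A : Set E₃} (hB : MeasurableSet B) (hA : MeasurableSet A) :
    μ⟦Y ⁻¹' B ∩ Z ⁻¹' A | MeasurableSpace.comap W inferInstance⟧ =ᵐ[μ]
      μ⟦Y ⁻¹' B | MeasurableSpace.comap W inferInstance⟧ *
        μ⟦Z ⁻¹' A | MeasurableSpace.comap W inferInstance⟧ ↔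
    ∀ C, MeasurableSet C → μ.map (fun ω => (W ω, Y ω, Z ω)) (C ×ˢ B ×ˢ A) =
      (lW.prod (lY.prod lZ)).withDensity (condProdDensity μ W Y Z lW lY lZ) (C ×ˢ B ×ˢ A) := by
  have hX : Measurable fun ω => (W ω, Y ω, Z ω) := hW.prodMk (hY.prodMk hZ)
  have h1 := condExp_ae_eq_condMass (μ := μ) (lW := lW) (lY := lY) hW hY hB
  have h2 := condExp_ae_eq_condMass (μ := μ) (lW := lW) (lY := lZ) hW hZ hA
  have hone : ∀ᵐ ω ∂μ, condMass μ W Y lW lY B (W ω) * condMass μ W Z lW lZ A (W ω) ≤ 1 := by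
    filter_upwards [condMass_ae_le_one (μ := μ) (lW := lW) (lY := lY) hW hY hB,
      condMass_ae_le_one (μ := μ) (lW := lW) (lY := lZ) hW hZ hA] with ω h1 h2
    exact mul_le_one' h1 h2
  have h3 := condExp_indicator_ae_eq_iff (μ := μ) hW ((hY hB).inter (hZ hA))
    (g := fun w => condMass μ W Y lW lY B w * condMass μ W Z lW lZ A w)
    ((measurable_condMass B).mul (measurable_condMass A)) hone
  have h4 : (fun ω => (condMass μ W Y lW lY B (W ω) * condMass μ W Z lW lZ A (W ω)).toReal) =ᵐ[μ]
      μ⟦Y ⁻¹' B | MeasurableSpace.comap W inferInstance⟧ *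
        μ⟦Z ⁻¹' A | MeasurableSpace.comap W inferInstance⟧ := by
    filter_upwards [h1, h2] with ω e1 e2
    rw [Pi.mul_apply, e1, e2, ENNReal.toReal_mul]
  have h5 : (μ⟦Y ⁻¹' B ∩ Z ⁻¹' A | MeasurableSpace.comap W inferInstance⟧ =ᵐ[μ]
      μ⟦Y ⁻¹' B | MeasurableSpace.comap W inferInstance⟧ *
        μ⟦Z ⁻¹' A | MeasurableSpace.comap W inferInstance⟧) ↔
      μ⟦Y ⁻¹' B ∩ Z ⁻¹' A | MeasurableSpace.comap W inferInstance⟧ =ᵐ[μ]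
      (fun ω => (condMass μ W Y lW lY B (W ω) * condMass μ W Z lW lZ A (W ω)).toReal) :=
    ⟨fun h => h.trans h4.symm, fun h => h.trans h4⟩
  rw [h5, h3]
  refine forall₂_congr fun C hC => ?_
  have hCBA := hC.prod (hB.prod hA)
  rw [withDensity_apply _ hCBA, setLIntegral_condProdDensity_eq hW hY hC hB A,
    Measure.map_apply hX hCBA]
  exact eq_comm

variable [HasPDF (fun ω => (W ω, Y ω, Z ω)) μ (lW.prod (lY.prod lZ))]

/-- The likelihood ratio of the conditionally independent coupling has expectation at most
one. -/
theorem lintegral_likelihoodRatio_le (hW : Measurable W) (hY : Measurable Y)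
    (hZ : Measurable Z) :
    ∫⁻ ω, condProdDensity μ W Y Z lW lY lZ (W ω, Y ω, Z ω) /
      pdf (fun ω => (W ω, Y ω, Z ω)) μ (lW.prod (lY.prod lZ)) (W ω, Y ω, Z ω) ∂μ ≤ 1 := by
  have hm : Measurable fun x => condProdDensity μ W Y Z lW lY lZ x /
      pdf (fun ω => (W ω, Y ω, Z ω)) μ (lW.prod (lY.prod lZ)) x :=
    measurable_condProdDensity.div (measurable_pdf _ _ _)
  rw [← pdf.lintegral_pdf_mul (X := fun ω => (W ω, Y ω, Z ω)) (μ := lW.prod (lY.prod lZ))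
    hm.aemeasurable]
  -- Only p · (q / p) ≤ q holds: any mass of q where p = 0 is lost.
  exact (lintegral_mono fun x => ENNReal.mul_div_le).trans
    (lintegral_condProdDensity_le hW hY hZ)

theorem condProdDensity_ae_eq_iff (hW : Measurable W) (hY : Measurable Y) (hZ : Measurable Z) :
    (∀ᵐ ω ∂μ, condProdDensity μ W Y Z lW lY lZ (W ω, Y ω, Z ω) =
      pdf (fun ω => (W ω, Y ω, Z ω)) μ (lW.prod (lY.prod lZ)) (W ω, Y ω, Z ω)) ↔
    μ.map (fun ω => (W ω, Y ω, Z ω)) =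
      (lW.prod (lY.prod lZ)).withDensity (condProdDensity μ W Y Z lW lY lZ) := by
  have hX : Measurable fun ω => (W ω, Y ω, Z ω) := hW.prodMk (hY.prodMk hZ)
  have hq := measurable_condProdDensity (μ := μ) (W := W) (Y := Y) (Z := Z) (lW := lW) (lY := lY)
    (lZ := lZ)
  have hp := measurable_pdf (fun ω => (W ω, Y ω, Z ω)) μ (lW.prod (lY.prod lZ))
  have hmap := map_eq_withDensity_pdf (fun ω => (W ω, Y ω, Z ω)) μ (lW.prod (lY.prod lZ))
  have hone : ∫⁻ x, pdf (fun ω => (W ω, Y ω, Z ω)) μ (lW.prod (lY.prod lZ)) x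
      ∂(lW.prod (lY.prod lZ)) = 1 := by
    rw [pdf.lintegral_eq_measure_univ]; simp
  constructor
  · intro h
    have h1 : ∀ᵐ x ∂(μ.map fun ω => (W ω, Y ω, Z ω)), condProdDensity μ W Y Z lW lY lZ x =
        pdf (fun ω => (W ω, Y ω, Z ω)) μ (lW.prod (lY.prod lZ)) x :=
      (ae_map_iff hX.aemeasurable (measurableSet_eq_fun hq hp)).2 h
    rw [hmap, ae_withDensity_iff hp] at h1
    rw [hmap]
    refine withDensity_congr_ae ?_
    -- Agreement is known only where p > 0. It still gives p ≤ q almost everywhere, and ∫ q ≤ 1 = ∫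
    -- p excludes excess mass of q where p = 0.
    refine ae_eq_of_ae_le_of_lintegral_le ?_ (by rw [hone]; simp) hq.aemeasurable
      (by rw [hone]; exact lintegral_condProdDensity_le hW hY hZ)
    filter_upwards [h1] with x hx
    by_cases h0 : pdf (fun ω => (W ω, Y ω, Z ω)) μ (lW.prod (lY.prod lZ)) x = 0
    · rw [h0]; exact zero_le
    · exact (hx h0).ge
  · intro h
    rw [hmap, withDensity_eq_iff hp.aemeasurable hq.aemeasurable (by rw [hone]; simp)] at h
    have hac : μ.map (fun ω => (W ω, Y ω, Z ω)) ≪ lW.prod (lY.prod lZ) :=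
      HasPDF.absolutelyContinuous
    filter_upwards [ae_of_ae_map hX.aemeasurable (hac.ae_le h)] with ω hω using hω.symm

/-- Conditional independence of `Y` and `Z` given `W` in terms of densities; it suffices to test
on a generating π-system for `Y`. -/
theorem condProdDensity_ae_eq_iff_condExp (hW : Measurable W) (hY : Measurable Y)
    (hZ : Measurable Z) {𝓑 : Set (Set E₂)} (hgen : MeasurableSpace.generateFrom 𝓑 = ‹_›)
    (hpi : IsPiSystem 𝓑) (huniv : Set.univ ∈ 𝓑) :
    (∀ᵐ ω ∂μ, condProdDensity μ W Y Z lW lY lZ (W ω, Y ω, Z ω) =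
      pdf (fun ω => (W ω, Y ω, Z ω)) μ (lW.prod (lY.prod lZ)) (W ω, Y ω, Z ω)) ↔
    ∀ B ∈ 𝓑, ∀ A, MeasurableSet A →
      μ⟦Y ⁻¹' B ∩ Z ⁻¹' A | MeasurableSpace.comap W inferInstance⟧ =ᵐ[μ]
        μ⟦Y ⁻¹' B | MeasurableSpace.comap W inferInstance⟧ *
          μ⟦Z ⁻¹' A | MeasurableSpace.comap W inferInstance⟧ := by
  have hmeas : ∀ B ∈ 𝓑, MeasurableSet B := fun B hB =>
    hgen ▸ MeasurableSpace.measurableSet_generateFrom hB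
  have hX : Measurable fun ω => (W ω, Y ω, Z ω) := hW.prodMk (hY.prodMk hZ)
  rw [condProdDensity_ae_eq_iff hW hY hZ]
  constructor
  · intro h B hB A hA
    rw [condExp_inter_ae_eq_mul_iff (lW := lW) (lY := lY) (lZ := lZ) hW hY hZ (hmeas B hB) hA]
    intro C _
    rw [h]
  · intro h
    have hspan : IsCountablySpanning 𝓑 := ⟨fun _ => Set.univ, fun _ => huniv, Set.iUnion_const _⟩
    have hYZ := generateFrom_eq_prod hgen
      (MeasurableSpace.generateFrom_measurableSet (α := E₃)) hspan
      isCountablySpanning_measurableSet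
    have hWYZ := generateFrom_eq_prod (MeasurableSpace.generateFrom_measurableSet (α := E₁)) hYZ
      isCountablySpanning_measurableSet (hspan.prod isCountablySpanning_measurableSet)
    have key : ∀ C, MeasurableSet C → ∀ B ∈ 𝓑, ∀ A, MeasurableSet A →
        μ.map (fun ω => (W ω, Y ω, Z ω)) (C ×ˢ B ×ˢ A) =
        (lW.prod (lY.prod lZ)).withDensity (condProdDensity μ W Y Z lW lY lZ) (C ×ˢ B ×ˢ A) :=
      fun C hC B hB A hA => (condExp_inter_ae_eq_mul_iff hW hY hZ (hmeas B hB) hA).1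
        (h B hB A hA) C hC
    have : IsProbabilityMeasure (μ.map fun ω => (W ω, Y ω, Z ω)) :=
      Measure.isProbabilityMeasure_map hX.aemeasurable
    refine ext_of_generate_finite _ hWYZ.symm (MeasurableSpace.isPiSystem_measurableSet.prod
      (hpi.prod MeasurableSpace.isPiSystem_measurableSet)) ?_ ?_
    · rintro _ ⟨C, hC, _, ⟨B, hB, A, hA, rfl⟩, rfl⟩
      exact key C hC B hB A hA
    · have := key _ MeasurableSet.univ _ huniv _ MeasurableSet.univ
      simpa only [Set.univ_prod_univ] using this

end ConditionalProduct

end HanEntropy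

namespace HanEntropy

/-! ### Gibbs' inequality and almost sure properties of densities. -/

section Gibbs

open scoped ENNReal

variable {Ω : Type*} [MeasurableSpace Ω] {μ : Measure Ω} [IsProbabilityMeasure μ]

/-- Gibbs' inequality, with the equality case, for a likelihood ratio. -/
theorem integral_log_nonpos_of_lintegral_le_one {r : Ω → ℝ≥0∞} (hr : AEMeasurable r μ)
    (h1 : ∫⁻ ω, r ω ∂μ ≤ 1) (hpos : ∀ᵐ ω ∂μ, 0 < (r ω).toReal)
    (hlog : Integrable (fun ω => Real.log (r ω).toReal) μ) :
    ∫ ω, Real.log (r ω).toReal ∂μ ≤ 0 ∧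
      (∫ ω, Real.log (r ω).toReal ∂μ = 0 ↔ ∀ᵐ ω ∂μ, r ω = 1) := by
  have htop : ∫⁻ ω, r ω ∂μ ≠ ∞ := ne_top_of_le_ne_top ENNReal.one_ne_top h1
  have hint : Integrable (fun ω => (r ω).toReal) μ := integrable_toReal_of_lintegral_ne_top hr htop
  have hI : ∫ ω, (r ω).toReal ∂μ ≤ 1 := by
    rw [integral_toReal hr (ae_lt_top' hr htop)]
    exact ENNReal.toReal_le_of_le_ofReal zero_le_one (by simpa using h1)
  have hint1 : Integrable (fun ω => (r ω).toReal - 1) μ := hint.sub (integrable_const _)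
  -- The inequality log r ≤ r - 1 is strict for r ≠ 1, which yields both the bound and its equality
  -- case.
  have hg0 : 0 ≤ᵐ[μ] fun ω => (r ω).toReal - 1 - Real.log (r ω).toReal := by
    filter_upwards [hpos] with ω h
    have := Real.log_le_sub_one_of_pos h
    simp only [Pi.zero_apply]
    linarith
  have hgI : ∫ ω, ((r ω).toReal - 1 - Real.log (r ω).toReal) ∂μ =
      ∫ ω, (r ω).toReal ∂μ - 1 - ∫ ω, Real.log (r ω).toReal ∂μ := by
    rw [integral_sub hint1 hlog, integral_sub hint (integrable_const _)]
    simp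
  have hge := integral_nonneg_of_ae hg0
  refine ⟨by linarith, fun h => ?_, fun h => ?_⟩
  · have h0 := (integral_eq_zero_iff_of_nonneg_ae hg0 (hint1.sub hlog)).1 (by linarith)
    filter_upwards [hpos, h0] with ω hω h0ω
    by_contra hne
    have hne' : (r ω).toReal ≠ 1 := fun h => hne ((ENNReal.toReal_eq_one_iff _).1 h)
    have := Real.log_lt_sub_one_of_pos hω hne'
    simp only [Pi.zero_apply] at h0ω
    linarith
  · refine integral_eq_zero_of_ae ?_
    filter_upwards [h] with ω hω
    simp [hω]

theorem pdf_measurableEquiv_comp {E E' : Type*} [MeasurableSpace E] [MeasurableSpace E']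
    {l : Measure E} {l' : Measure E'} [SigmaFinite l] (e : E ≃ᵐ E') (he : MeasurePreserving e l l')
    {V : Ω → E} (hV : Measurable V) [HasPDF V μ l] :
    ∀ᵐ ω ∂μ, pdf (fun ω => e (V ω)) μ l' (e (V ω)) = pdf V μ l (V ω) := by
  have hac : μ.map V ≪ l := HasPDF.absolutelyContinuous
  have : IsProbabilityMeasure (μ.map V) := Measure.isProbabilityMeasure_map hV.aemeasurable
  have h := e.measurableEmbedding.rnDeriv_map (μ.map V) l
  rw [Measure.map_map e.measurable hV, he.map_eq] at h
  exact ae_of_ae_map hV.aemeasurable (hac.ae_le h)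

theorem pdf_toReal_pos {E : Type*} [MeasurableSpace E] {l : Measure E} {V : Ω → E}
    (hV : Measurable V) [HasPDF V μ l] : ∀ᵐ ω ∂μ, 0 < (pdf V μ l (V ω)).toReal := by
  have hac : μ.map V ≪ l := HasPDF.absolutelyContinuous
  have h1 := ae_of_ae_map hV.aemeasurable (Measure.rnDeriv_pos hac)
  have h2 := ae_of_ae_map hV.aemeasurable (hac.ae_le (@pdf.ae_lt_top _ _ _ _ μ _ l V))
  filter_upwards [h1, h2] with ω a b
  exact ENNReal.toReal_pos a.ne' b.ne

end Gibbs

/-! ### Densities and entropies of subvectors. -/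

section Subvector

variable {Ω : Type*} [MeasurableSpace Ω] {μ : Measure Ω} {n : ℕ} {X : Fin n → Ω → ℝ}

theorem measurable_subvector (hX : ∀ i, Measurable (X i)) (S : Finset (Fin n)) :
    Measurable (subvector X S) :=
  measurable_pi_lambda _ fun i => hX i

theorem measurable_density (S : Finset (Fin n)) : Measurable (density X μ S) :=
  (measurable_pdf _ _ _).ennreal_toReal

theorem piFinsetUnion_subvector {Ω : Type*} {X : Fin n → Ω → ℝ} {S T : Finset (Fin n)} (h : Disjoint S T) (ω : Ω) :
    MeasurableEquiv.piFinsetUnion (fun _ : Fin n => ℝ) h (subvector X S ω, subvector X T ω) =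
      subvector X (S ∪ T) ω := by
  funext ⟨i, hi⟩
  rcases Finset.mem_union.1 hi with hS | hT
  · exact Equiv.piFinsetUnion_left (fun _ => ℝ) h hS hi
  · exact Equiv.piFinsetUnion_right (fun _ => ℝ) h hT hi

variable [IsProbabilityMeasure μ]

theorem hasPDF_subvector (hpdf : HasPDF (fun ω i => X i ω) μ (volume : Measure (Fin n → ℝ)))
    (S : Finset (Fin n)) : HasPDF (subvector X S) μ volume := by
  have h1 := (volume_preserving_piEquivPiSubtypeProd (fun _ : Fin n => ℝ)
    (· ∈ S)).quasiMeasurePreserving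
  have h2 : Measure.QuasiMeasurePreserving (fun (x : Fin n → ℝ) (i : S) => x i) volume volume := by
    convert Measure.quasiMeasurePreserving_fst.comp h1 <;> rfl
  exact pdf.quasiMeasurePreserving_hasPDF' (fun ω i => X i ω) h2

theorem density_subvector_pos (hX : ∀ i, Measurable (X i))
    (hpdf : HasPDF (fun ω i => X i ω) μ (volume : Measure (Fin n → ℝ))) (S : Finset (Fin n)) :
    ∀ᵐ ω ∂μ, 0 < density X μ S (subvector X S ω) := by
  have := hasPDF_subvector hpdf S
  exact pdf_toReal_pos (measurable_subvector hX S)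

theorem integrable_log_density
    (hpdf : HasPDF (fun ω i => X i ω) μ (volume : Measure (Fin n → ℝ))) {S : Finset (Fin n)}
    (hfin : FiniteDiffEntropy X μ S) :
    Integrable (fun ω => Real.log (density X μ S (subvector X S ω))) μ := by
  have := hasPDF_subvector hpdf S
  exact (pdf.integrable_pdf_smul_iff (X := subvector X S) (μ := volume)
    (f := fun x => Real.log (density X μ S x))
    (measurable_density S).log.aestronglyMeasurable).1 hfin

theorem diffEntropy_eq_neg_integral_log
    (hpdf : HasPDF (fun ω i => X i ω) μ (volume : Measure (Fin n → ℝ))) (S : Finset (Fin n)) :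
    diffEntropy X μ S = -∫ ω, Real.log (density X μ S (subvector X S ω)) ∂μ := by
  have := hasPDF_subvector hpdf S
  rw [diffEntropy, ← pdf.integral_pdf_smul (X := subvector X S) (μ := volume)
    (f := fun x => Real.log (density X μ S x))
    (measurable_density S).log.aestronglyMeasurable]
  rfl

/-- Chain rule: written as expectations, the logarithm of the ratio splits because both densities
are almost surely positive, and the integral splits because both entropies are finite. -/
theorem condDiffEntropy_eq_sub (hX : ∀ i, Measurable (X i))
    (hpdf : HasPDF (fun ω i => X i ω) μ (volume : Measure (Fin n → ℝ)))
    (hfin : ∀ S, FiniteDiffEntropy X μ S) (S T : Finset (Fin n)) :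
    condDiffEntropy X μ S T = diffEntropy X μ (S ∪ T) - diffEntropy X μ T := by
  have := hasPDF_subvector hpdf (S ∪ T)
  have hm : Measurable fun x : (S ∪ T : Finset (Fin n)) → ℝ => Real.log (density X μ (S ∪ T) x /
      density X μ T (Finset.restrict₂ (π := fun _ => ℝ) Finset.subset_union_right x)) :=
    ((measurable_density _).div ((measurable_density T).comp (Finset.measurable_restrict₂ _))).log
  have h1 : condDiffEntropy X μ S T = -∫ ω, Real.log (density X μ (S ∪ T) (subvector X (S ∪ T) ω) /
      density X μ T (subvector X T ω)) ∂μ := by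
    rw [condDiffEntropy]
    exact congrArg Neg.neg (pdf.integral_pdf_smul (X := subvector X (S ∪ T)) (μ := volume)
      hm.aestronglyMeasurable)
  rw [h1, diffEntropy_eq_neg_integral_log hpdf, diffEntropy_eq_neg_integral_log hpdf,
    sub_neg_eq_add, neg_add_eq_sub, ← neg_sub, ← integral_sub
      (integrable_log_density hpdf (hfin _)) (integrable_log_density hpdf (hfin _))]
  congr 1
  refine integral_congr_ae ?_
  filter_upwards [density_subvector_pos hX hpdf (S ∪ T), density_subvector_pos hX hpdf T]
    with ω h1 h2
  rw [Real.log_div h1.ne' h2.ne']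

theorem diffEntropy_empty
    (hpdf : HasPDF (fun ω i => X i ω) μ (volume : Measure (Fin n → ℝ))) :
    diffEntropy X μ ∅ = 0 := by
  have := hasPDF_subvector hpdf ∅
  -- Lebesgue measure on ℝ^∅ is a unit point mass, so total mass one forces the density to be 1.
  have hvol : (volume : Measure ((∅ : Finset (Fin n)) → ℝ)) = Measure.dirac isEmptyElim := by
    rw [volume_pi, Measure.pi_of_empty]
  have h1 : ∫⁻ x, pdf (subvector X ∅) μ volume x = 1 := by
    rw [pdf.lintegral_eq_measure_univ]; simp
  rw [hvol, lintegral_dirac] at h1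
  have h2 : density X μ ∅ = fun _ => 1 := by
    funext x
    rw [density, Subsingleton.elim x isEmptyElim, hvol, h1]
    simp
  simp [diffEntropy, h2]

theorem hasPDF_subvector_pair
    (hpdf : HasPDF (fun ω i => X i ω) μ (volume : Measure (Fin n → ℝ)))
    {S T : Finset (Fin n)} (h : Disjoint S T) :
    HasPDF (fun ω => (subvector X S ω, subvector X T ω)) μ (volume.prod volume) := by
  have := hasPDF_subvector hpdf (S ∪ T)
  have hq := ((volume_preserving_piFinsetUnion (fun _ : Fin n => ℝ) h).symm _).quasiMeasurePreserving
  have h1 := @pdf.quasiMeasurePreserving_hasPDF' _ _ _ _ μ _ _ _ _ (subvector X (S ∪ T)) _ _ _ _ hq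
  refine h1.congr (Filter.Eventually.of_forall fun ω => ?_)
  simp only [Function.comp_apply]
  rw [← piFinsetUnion_subvector h, MeasurableEquiv.symm_apply_apply]

/-- The identification of ℝ^S × ℝ^T with ℝ^(S ∪ T) preserves volume, so no Jacobian appears. -/
theorem pdf_subvector_pair (hX : ∀ i, Measurable (X i))
    (hpdf : HasPDF (fun ω i => X i ω) μ (volume : Measure (Fin n → ℝ)))
    {S T : Finset (Fin n)} (h : Disjoint S T) :
    ∀ᵐ ω ∂μ, pdf (subvector X (S ∪ T)) μ volume (subvector X (S ∪ T) ω) =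
      pdf (fun ω => (subvector X S ω, subvector X T ω)) μ (volume.prod volume)
        (subvector X S ω, subvector X T ω) := by
  have := hasPDF_subvector_pair hpdf h
  have h1 := pdf_measurableEquiv_comp (μ := μ) _
    (volume_preserving_piFinsetUnion (fun _ : Fin n => ℝ) h)
    ((measurable_subvector hX S).prodMk (measurable_subvector hX T))
  simp only [piFinsetUnion_subvector] at h1
  exact h1

end Subvector

end HanEntropy

namespace HanEntropy

/-! ### Submodularity of entropy and its equality cases. -/

section ConditionalIndependence

open scoped ENNReal

variable {Ω : Type*} [MeasurableSpace Ω] {μ : Measure Ω} [IsProbabilityMeasure μ] {n : ℕ}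
  {X : Fin n → Ω → ℝ}

theorem hasPDF_subvector_triple
    (hpdf : HasPDF (fun ω i => X i ω) μ (volume : Measure (Fin n → ℝ)))
    {L S T : Finset (Fin n)} (hST : Disjoint S T) (hL : Disjoint L (S ∪ T)) :
    HasPDF (fun ω => (subvector X L ω, subvector X S ω, subvector X T ω)) μ
      (volume.prod (volume.prod volume)) := by
  have := hasPDF_subvector_pair hpdf hL
  have hq := ((MeasurePreserving.id (volume : Measure (L → ℝ))).prod
    ((volume_preserving_piFinsetUnion (fun _ : Fin n => ℝ) hST).symm _)).quasiMeasurePreserving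
  have h1 := @pdf.quasiMeasurePreserving_hasPDF' _ _ _ _ μ _ _ _ _
    (fun ω => (subvector X L ω, subvector X (S ∪ T) ω)) _ _ _ _ hq
  refine h1.congr (Filter.Eventually.of_forall fun ω => ?_)
  simp only [Function.comp_apply, Prod.map_apply, id_eq]
  rw [← piFinsetUnion_subvector hST, MeasurableEquiv.symm_apply_apply]

theorem pdf_subvector_triple (hX : ∀ i, Measurable (X i))
    (hpdf : HasPDF (fun ω i => X i ω) μ (volume : Measure (Fin n → ℝ)))
    {L S T : Finset (Fin n)} (hST : Disjoint S T) (hL : Disjoint L (S ∪ T)) :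
    ∀ᵐ ω ∂μ, pdf (subvector X (L ∪ (S ∪ T))) μ volume (subvector X (L ∪ (S ∪ T)) ω) =
      pdf (fun ω => (subvector X L ω, subvector X S ω, subvector X T ω)) μ
        (volume.prod (volume.prod volume))
        (subvector X L ω, subvector X S ω, subvector X T ω) := by
  have := hasPDF_subvector_triple hpdf hST hL
  have he : MeasurePreserving (MeasurableEquiv.prodCongr (MeasurableEquiv.refl (L → ℝ))
      (MeasurableEquiv.piFinsetUnion (fun _ : Fin n => ℝ) hST))
      (volume.prod (volume.prod volume)) (volume.prod volume) :=
    (MeasurePreserving.id volume).prod (volume_preserving_piFinsetUnion (fun _ : Fin n => ℝ) hST)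
  have h1 := pdf_measurableEquiv_comp (μ := μ) _ he ((measurable_subvector hX L).prodMk
    ((measurable_subvector hX S).prodMk (measurable_subvector hX T)))
  filter_upwards [h1, pdf_subvector_pair hX hpdf hL] with ω h1 h2
  rw [h2, ← h1]
  have : ∀ ω, MeasurableEquiv.prodCongr (MeasurableEquiv.refl (L → ℝ))
      (MeasurableEquiv.piFinsetUnion (fun _ : Fin n => ℝ) hST)
      (subvector X L ω, subvector X S ω, subvector X T ω) =
      (subvector X L ω, subvector X (S ∪ T) ω) := fun ω => by
    rw [← piFinsetUnion_subvector hST]; rfl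
  simp only [this]

/-- Submodularity of differential entropy on disjoint blocks, with the equality case in terms of
densities. -/
theorem diffEntropy_add_le_of_disjoint (hX : ∀ i, Measurable (X i))
    (hpdf : HasPDF (fun ω i => X i ω) μ (volume : Measure (Fin n → ℝ)))
    (hfin : ∀ S, FiniteDiffEntropy X μ S) {L S T : Finset (Fin n)} (hST : Disjoint S T)
    (hLS : Disjoint L S) (hLT : Disjoint L T) :
    diffEntropy X μ (L ∪ (S ∪ T)) + diffEntropy X μ L ≤
        diffEntropy X μ (L ∪ S) + diffEntropy X μ (L ∪ T) ∧
      (diffEntropy X μ (L ∪ (S ∪ T)) + diffEntropy X μ L =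
        diffEntropy X μ (L ∪ S) + diffEntropy X μ (L ∪ T) ↔
      ∀ᵐ ω ∂μ, condProdDensity μ (subvector X L) (subvector X S) (subvector X T) volume volume
          volume (subvector X L ω, subvector X S ω, subvector X T ω) =
        pdf (fun ω => (subvector X L ω, subvector X S ω, subvector X T ω)) μ
          (volume.prod (volume.prod volume))
          (subvector X L ω, subvector X S ω, subvector X T ω)) := by
  have hL : Disjoint L (S ∪ T) := Finset.disjoint_union_right.2 ⟨hLS, hLT⟩
  have i1 := hasPDF_subvector hpdf L
  have i2 := hasPDF_subvector_pair hpdf hLS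
  have i3 := hasPDF_subvector_pair hpdf hLT
  have i4 := hasPDF_subvector_triple hpdf hST hL
  have mL := measurable_subvector hX L
  have mS := measurable_subvector hX S
  have mT := measurable_subvector hX T
  have hle := lintegral_likelihoodRatio_le (μ := μ) (lW := volume) (lY := volume) (lZ := volume)
    mL mS mT
  set r : Ω → ℝ≥0∞ := fun ω =>
    condProdDensity μ (subvector X L) (subvector X S) (subvector X T) volume volume
        volume (subvector X L ω, subvector X S ω, subvector X T ω) /
      pdf (fun ω => (subvector X L ω, subvector X S ω, subvector X T ω)) μ
        (volume.prod (volume.prod volume))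
        (subvector X L ω, subvector X S ω, subvector X T ω) with hr
  have mr : Measurable r := (measurable_condProdDensity.comp (mL.prodMk (mS.prodMk mT))).div
    ((measurable_pdf _ _ _).comp (mL.prodMk (mS.prodMk mT)))
  have p4 := pdf_toReal_pos (μ := μ) (l := volume.prod (volume.prod volume))
    (mL.prodMk (mS.prodMk mT))
  -- Almost surely r = f_{LS} f_{LT} / (f_L f_{LST}) with all factors positive and finite, so E log
  -- r is the entropy difference sought.
  have hval : ∀ᵐ ω ∂μ, 0 < (r ω).toReal ∧ Real.log (r ω).toReal =
      Real.log (density X μ (L ∪ S) (subvector X (L ∪ S) ω)) +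
        Real.log (density X μ (L ∪ T) (subvector X (L ∪ T) ω)) -
        (Real.log (density X μ (L ∪ (S ∪ T)) (subvector X (L ∪ (S ∪ T)) ω)) +
        Real.log (density X μ L (subvector X L ω))) := by
    filter_upwards [density_subvector_pos hX hpdf (L ∪ S), density_subvector_pos hX hpdf (L ∪ T),
      density_subvector_pos hX hpdf (L ∪ (S ∪ T)), density_subvector_pos hX hpdf L,
      pdf_subvector_pair hX hpdf hLS, pdf_subvector_pair hX hpdf hLT,
      pdf_subvector_triple hX hpdf hST hL] with ω h1 h2 h3 h4 e1 e2 e3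
    have e : (r ω).toReal = (density X μ L (subvector X L ω))⁻¹ *
        (density X μ (L ∪ S) (subvector X (L ∪ S) ω) *
          density X μ (L ∪ T) (subvector X (L ∪ T) ω)) /
        density X μ (L ∪ (S ∪ T)) (subvector X (L ∪ (S ∪ T)) ω) := by
      simp only [hr, density, e1, e2, e3, condProdDensity, ENNReal.toReal_div, ENNReal.toReal_mul,
        ENNReal.toReal_inv]
    rw [e]
    refine ⟨by positivity, ?_⟩
    rw [Real.log_div (by positivity) h3.ne', Real.log_mul (by positivity) (by positivity),
      Real.log_mul h1.ne' h2.ne', Real.log_inv]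
    ring
  have iLS := integrable_log_density hpdf (hfin (L ∪ S))
  have iLT := integrable_log_density hpdf (hfin (L ∪ T))
  have iLST := integrable_log_density hpdf (hfin (L ∪ (S ∪ T)))
  have iL := integrable_log_density hpdf (hfin L)
  have iadd : Integrable (fun ω => Real.log (density X μ (L ∪ S) (subvector X (L ∪ S) ω)) +
      Real.log (density X μ (L ∪ T) (subvector X (L ∪ T) ω))) μ := iLS.add iLT
  have iadd' : Integrable (fun ω =>
      Real.log (density X μ (L ∪ (S ∪ T)) (subvector X (L ∪ (S ∪ T)) ω)) +
      Real.log (density X μ L (subvector X L ω))) μ := iLST.add iL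
  have hlog := hval.mono fun ω h => h.2
  have hint : Integrable (fun ω => Real.log (r ω).toReal) μ :=
    (iadd.sub iadd').congr (hlog.mono fun ω h => h.symm)
  have hI : ∫ ω, Real.log (r ω).toReal ∂μ =
      diffEntropy X μ (L ∪ (S ∪ T)) + diffEntropy X μ L -
        (diffEntropy X μ (L ∪ S) + diffEntropy X μ (L ∪ T)) := by
    simp only [diffEntropy_eq_neg_integral_log hpdf]
    rw [integral_congr_ae hlog, integral_sub iadd iadd', integral_add iLS iLT,
      integral_add iLST iL]
    ring
  obtain ⟨g1, g2⟩ := integral_log_nonpos_of_lintegral_le_one mr.aemeasurable hle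
    (hval.mono fun ω h => h.1) hint
  rw [hI] at g1 g2
  refine ⟨by linarith, ?_⟩
  rw [← sub_eq_zero, g2]
  refine Filter.eventually_congr ?_
  filter_upwards [p4] with ω h4
  rw [ENNReal.toReal_pos_iff] at h4
  exact ENNReal.div_eq_one_iff h4.1.ne' h4.2.ne

/-- The sets A and B are cut into the disjoint blocks A ∩ B, A \ B and B \ A, with A ∩ B as the
conditioning block. -/
theorem isSubmodular_diffEntropy (hX : ∀ i, Measurable (X i))
    (hpdf : HasPDF (fun ω i => X i ω) μ (volume : Measure (Fin n → ℝ)))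
    (hfin : ∀ S, FiniteDiffEntropy X μ S) : IsSubmodular (diffEntropy X μ) := by
  intro A B
  have h := (diffEntropy_add_le_of_disjoint hX hpdf hfin (L := A ∩ B) (S := A \ B) (T := B \ A)
    disjoint_sdiff_sdiff (Finset.disjoint_sdiff_inter A B).symm
    (by rw [Finset.inter_comm]; exact (Finset.disjoint_sdiff_inter B A).symm)).1
  have e1 : A ∩ B ∪ (A \ B ∪ B \ A) = A ∪ B := by ext; simp; tauto
  have e2 : A ∩ B ∪ A \ B = A := by ext; simp; tauto
  have e3 : A ∩ B ∪ B \ A = B := by ext; simp; tauto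
  rwa [e1, e2, e3] at h

/-- The π-system is left free for two uses: boxes, for mutual conditional independence of
coordinates, and all measurable sets, for independence of vectors. -/
theorem diffEntropy_add_eq_iff_condExp (hX : ∀ i, Measurable (X i))
    (hpdf : HasPDF (fun ω i => X i ω) μ (volume : Measure (Fin n → ℝ)))
    (hfin : ∀ S, FiniteDiffEntropy X μ S) {L S T : Finset (Fin n)} (hST : Disjoint S T)
    (hLS : Disjoint L S) (hLT : Disjoint L T) {𝓑 : Set (Set (S → ℝ))}
    (hgen : MeasurableSpace.generateFrom 𝓑 = MeasurableSpace.pi) (hpi : IsPiSystem 𝓑)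
    (huniv : Set.univ ∈ 𝓑) :
    diffEntropy X μ (L ∪ (S ∪ T)) + diffEntropy X μ L =
        diffEntropy X μ (L ∪ S) + diffEntropy X μ (L ∪ T) ↔
      ∀ B ∈ 𝓑, ∀ A, MeasurableSet A →
      μ⟦subvector X S ⁻¹' B ∩ subvector X T ⁻¹' A | sigmaOf X L⟧ =ᵐ[μ]
        μ⟦subvector X S ⁻¹' B | sigmaOf X L⟧ * μ⟦subvector X T ⁻¹' A | sigmaOf X L⟧ := by
  have hL : Disjoint L (S ∪ T) := Finset.disjoint_union_right.2 ⟨hLS, hLT⟩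
  have i1 := hasPDF_subvector hpdf L
  have i2 := hasPDF_subvector_pair hpdf hLS
  have i3 := hasPDF_subvector_pair hpdf hLT
  have i4 := hasPDF_subvector_triple hpdf hST hL
  rw [(diffEntropy_add_le_of_disjoint hX hpdf hfin hST hLS hLT).2]
  exact condProdDensity_ae_eq_iff_condExp (measurable_subvector hX L) (measurable_subvector hX S)
    (measurable_subvector hX T) hgen hpi huniv

/-- Additivity of the contraction and mutual conditional independence both amount to splitting X_i
off from X_R given X_L, for every R ⊆ P and i in P \ R. -/
theorem condIndepGiven_iff_contract_eq_sum (hX : ∀ i, Measurable (X i))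
    (hpdf : HasPDF (fun ω i => X i ω) μ (volume : Measure (Fin n → ℝ)))
    (hfin : ∀ S, FiniteDiffEntropy X μ S) {P L : Finset (Fin n)} (hPL : Disjoint P L) :
    CondIndepGiven X μ P L ↔
      contract (diffEntropy X μ) L P = ∑ i ∈ P, contract (diffEntropy X μ) L {i} := by
  rw [(isSubmodular_diffEntropy hX hpdf hfin).contract_eq_sum_iff]
  have hbox : ∀ R : Finset (Fin n), ∀ A : Fin n → Set ℝ,
      subvector X R ⁻¹' (Set.univ.pi fun j : R => A j) = ⋂ j ∈ R, X j ⁻¹' A j := by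
    intro R A
    ext ω
    simp [subvector]
  have key : ∀ R ⊆ P, ∀ i ∈ P, i ∉ R →
      (diffEntropy X μ ({i} ∪ (R ∪ L)) + diffEntropy X μ L =
        diffEntropy X μ ({i} ∪ L) + diffEntropy X μ (R ∪ L) ↔
      ∀ A : Fin n → Set ℝ, (∀ j ∈ insert i R, MeasurableSet (A j)) →
        μ⟦(⋂ j ∈ R, X j ⁻¹' A j) ∩ X i ⁻¹' A i | sigmaOf X L⟧ =ᵐ[μ]
          μ⟦⋂ j ∈ R, X j ⁻¹' A j | sigmaOf X L⟧ * μ⟦X i ⁻¹' A i | sigmaOf X L⟧) := by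
    intro R hR i hi hiR
    have h := diffEntropy_add_eq_iff_condExp hX hpdf hfin (L := L) (S := R) (T := {i})
      (by simpa using hiR) (Finset.disjoint_of_subset_left hR hPL).symm
      (by simpa using Finset.disjoint_left.1 hPL hi) generateFrom_pi isPiSystem_pi
      ⟨fun _ => Set.univ, by simp, by simp⟩
    have e1 : L ∪ (R ∪ {i}) = {i} ∪ (R ∪ L) := by
      rw [Finset.union_comm L, Finset.union_comm R, Finset.union_assoc]
    rw [e1, Finset.union_comm L R, Finset.union_comm L {i}, add_comm (diffEntropy X μ (R ∪ L))] at h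
    rw [h]
    constructor
    · intro h A hA
      have h1 := h _ ⟨fun j : R => A j, fun j _ => hA j (Finset.mem_insert_of_mem j.2), rfl⟩
        {x | x ⟨i, Finset.mem_singleton_self i⟩ ∈ A i}
        ((measurable_pi_apply _) (hA i (Finset.mem_insert_self _ _)))
      rw [hbox R A] at h1
      exact h1
    · rintro h _ ⟨A, hA, rfl⟩ C hC
      -- One family encodes the box on R and the set C ⊆ ℝ^{i}, read as a subset of ℝ. Since i ∉ R
      -- they do not collide.
      set A' : Fin n → Set ℝ := fun j => if hj : j ∈ R then A ⟨j, hj⟩ else {t | (fun _ => t) ∈ C}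
        with hA'
      have e2 : (Set.univ.pi A) = Set.univ.pi fun j : R => A' j := by
        congr 1; funext j; simp [hA']
      have e3 : subvector X {i} ⁻¹' C = X i ⁻¹' A' i := by
        ext ω
        have : subvector X {i} ω = fun _ => X i ω := by
          funext ⟨j, hj⟩
          rw [Finset.mem_singleton] at hj
          subst hj; rfl
        simp [hA', hiR, this]
      rw [e2, e3, hbox R A']
      refine h A' fun j hj => ?_
      by_cases hjR : j ∈ R
      · simp only [hA', hjR, dif_pos]
        exact hA ⟨j, hjR⟩ trivial
      · simp only [hA', hjR, dif_neg, not_false_iff]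
        exact (measurable_pi_lambda (fun (t : ℝ) (_ : ({i} : Finset (Fin n))) => t)
          fun _ => measurable_id) hC
  have hins : ∀ (R : Finset (Fin n)) (i : Fin n) (A : Fin n → Set ℝ),
      (⋂ j ∈ R, X j ⁻¹' A j) ∩ X i ⁻¹' A i = ⋂ j ∈ insert i R, X j ⁻¹' A j := by
    intro R i A
    rw [Finset.set_biInter_insert, Set.inter_comm]
  constructor
  · intro h R hR i hi hiR
    rw [key R hR i hi hiR]
    intro A hA
    have h1 := h (insert i R) (Finset.insert_subset hi hR) A hA
    have h2 := h R hR A fun j hj => hA j (Finset.mem_insert_of_mem hj)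
    rw [hins]
    rw [Finset.prod_insert hiR, mul_comm] at h1
    exact h1.trans (h2.symm.mul (Filter.EventuallyEq.refl _ _))
  · intro h R
    induction R using Finset.induction_on with
    | empty =>
      intro _ A _
      have hm : sigmaOf X L ≤ (inferInstance : MeasurableSpace Ω) :=
        (measurable_subvector hX L).comap_le
      simp [condExp_const hm, Pi.one_def]
    | insert i R hiR ih =>
      intro hR A hA
      rw [Finset.insert_subset_iff] at hR
      have h1 := ih hR.2 A fun j hj => hA j (Finset.mem_insert_of_mem hj)
      have h2 := (key R hR.2 i hR.1 hiR).1 (h R hR.2 i hR.1 hiR) A hA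
      rw [hins] at h2
      rw [Finset.prod_insert hiR, mul_comm]
      exact h2.trans (h1.mul (Filter.EventuallyEq.refl _ _))

/-- X_∅ is constant, so it generates the trivial σ-algebra. This makes unconditional independence
the case of empty conditioning. -/
theorem condExp_indicator_sigmaOf_empty {s : Set Ω} (hs : MeasurableSet s) :
    μ⟦s | sigmaOf X ∅⟧ = fun _ => μ.real s := by
  have h : sigmaOf X ∅ = ⊥ := by
    have : subvector X ∅ = fun _ => isEmptyElim := by
      funext ω; exact Subsingleton.elim _ _
    rw [sigmaOf, this, MeasurableSpace.comap_const]
  rw [h, condExp_bot]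
  funext _
  exact integral_indicator_one hs

theorem ae_const_eq_iff {a b : ℝ} : ((fun _ : Ω => a) =ᵐ[μ] fun _ => b) ↔ a = b :=
  Filter.eventually_const

theorem condIndepGiven_empty_iff (hX : ∀ i, Measurable (X i)) (S : Finset (Fin n)) :
    CondIndepGiven X μ S ∅ ↔ iIndepFun (fun i : S => X i) μ := by
  have hmul : ∀ (R : Finset (Fin n)) (A : Fin n → Set ℝ), (∀ i ∈ R, MeasurableSet (A i)) →
      ((μ⟦⋂ i ∈ R, X i ⁻¹' A i | sigmaOf X ∅⟧ =ᵐ[μ] ∏ i ∈ R, μ⟦X i ⁻¹' A i | sigmaOf X ∅⟧) ↔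
        μ (⋂ i ∈ R, X i ⁻¹' A i) = ∏ i ∈ R, μ (X i ⁻¹' A i)) := by
    intro R A hA
    have h1 : ∏ i ∈ R, μ⟦X i ⁻¹' A i | sigmaOf X ∅⟧ = fun _ => ∏ i ∈ R, μ.real (X i ⁻¹' A i) := by
      rw [Finset.prod_congr rfl fun i hi => condExp_indicator_sigmaOf_empty (hX i (hA i hi))]
      funext _
      rw [Finset.prod_apply]
    rw [h1, condExp_indicator_sigmaOf_empty
      (Finset.measurableSet_biInter R fun i hi => hX i (hA i hi)), ae_const_eq_iff]
    simp only [Measure.real]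
    rw [← ENNReal.toReal_prod, ENNReal.toReal_eq_toReal_iff' (measure_ne_top _ _)
      (ENNReal.prod_ne_top fun i _ => measure_ne_top _ _)]
  rw [iIndepFun_iff_measure_inter_preimage_eq_mul]
  constructor
  · intro h R sets hsets
    set A : Fin n → Set ℝ := fun j => if hj : j ∈ S then sets ⟨j, hj⟩ else Set.univ with hA
    have hAi : ∀ i : S, A i = sets i := fun i => by simp [hA]
    have hm : ∀ i ∈ R.map (Function.Embedding.subtype (· ∈ S)), MeasurableSet (A i) := by
      intro i hi
      obtain ⟨j, hj, rfl⟩ := Finset.mem_map.1 hi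
      exact (hAi j).symm ▸ hsets j hj
    have h1 := (hmul _ A hm).1 (h _ (Finset.map_subtype_subset R) A hm)
    rw [Finset.prod_map] at h1
    have e : ⋂ i ∈ R.map (Function.Embedding.subtype (· ∈ S)), X i ⁻¹' A i =
        ⋂ i ∈ R, X i ⁻¹' sets i := by
      ext ω
      simp only [Set.mem_iInter, Finset.forall_mem_map, Function.Embedding.subtype_apply, hAi]
    rw [e] at h1
    simpa only [Function.Embedding.subtype_apply, hAi] using h1
  · intro h R hR A hA
    rw [hmul R A hA]
    obtain ⟨R', rfl⟩ : ∃ R' : Finset S, R = R'.map (Function.Embedding.subtype (· ∈ S)) :=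
      ⟨R.subtype (· ∈ S), (Finset.subtype_map_of_mem fun i hi => hR hi).symm⟩
    have h1 := h R' (sets := fun i => A i) fun i hi => hA _ (Finset.mem_map_of_mem _ hi)
    have e : ⋂ i ∈ R'.map (Function.Embedding.subtype (· ∈ S)), X i ⁻¹' A i =
        ⋂ i ∈ R', X i ⁻¹' A i := by
      ext ω
      simp only [Set.mem_iInter, Finset.forall_mem_map, Function.Embedding.subtype_apply]
    rw [Finset.prod_map, e]
    exact h1

theorem indepFun_subvector_iff (hX : ∀ i, Measurable (X i))
    (hpdf : HasPDF (fun ω i => X i ω) μ (volume : Measure (Fin n → ℝ)))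
    (hfin : ∀ S, FiniteDiffEntropy X μ S) {S T : Finset (Fin n)} (hST : Disjoint S T) :
    IndepFun (subvector X S) (subvector X T) μ ↔
      diffEntropy X μ (S ∪ T) = diffEntropy X μ S + diffEntropy X μ T := by
  have h := diffEntropy_add_eq_iff_condExp hX hpdf hfin (L := ∅) hST (by simp) (by simp)
    MeasurableSpace.generateFrom_measurableSet MeasurableSpace.isPiSystem_measurableSet
    (by simp)
  simp only [Finset.empty_union, diffEntropy_empty hpdf, add_zero] at h
  rw [h, indepFun_iff_measure_inter_preimage_eq_mul]
  have hS := measurable_subvector hX S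
  have hT := measurable_subvector hX T
  have hmul : ∀ B A, MeasurableSet B → MeasurableSet A →
      ((μ⟦subvector X S ⁻¹' B ∩ subvector X T ⁻¹' A | sigmaOf X ∅⟧ =ᵐ[μ]
        μ⟦subvector X S ⁻¹' B | sigmaOf X ∅⟧ * μ⟦subvector X T ⁻¹' A | sigmaOf X ∅⟧) ↔
      μ (subvector X S ⁻¹' B ∩ subvector X T ⁻¹' A) =
        μ (subvector X S ⁻¹' B) * μ (subvector X T ⁻¹' A)) := by
    intro B A hB hA
    rw [condExp_indicator_sigmaOf_empty ((hS hB).inter (hT hA)),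
      condExp_indicator_sigmaOf_empty (hS hB), condExp_indicator_sigmaOf_empty (hT hA)]
    refine (ae_const_eq_iff (μ := μ) (b := μ.real (subvector X S ⁻¹' B) *
      μ.real (subvector X T ⁻¹' A))).trans ?_
    simp only [Measure.real]
    rw [← ENNReal.toReal_mul, ENNReal.toReal_eq_toReal_iff' (measure_ne_top _ _)
      (ENNReal.mul_ne_top (measure_ne_top _ _) (measure_ne_top _ _))]
  exact ⟨fun h B hB A hA => (hmul B A hB hA).2 (h B A hB hA),
    fun h B A hB hA => (hmul B A hB hA).1 (h B hB A hA)⟩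

end ConditionalIndependence

end HanEntropy

namespace HanEntropy

/-! ### The two index blocks and the final assembly. -/

theorem card_firstBlock {n p : ℕ} (h : p ≤ n) : (firstBlock n p).card = p := by
  rw [firstBlock, Fin.card_filter_val_lt, min_eq_right h]

theorem firstBlock_union_lastBlock (n p : ℕ) : firstBlock n p ∪ lastBlock n p = Finset.univ := by
  ext i
  simpa [firstBlock, lastBlock] using lt_or_ge i.val p

theorem disjoint_firstBlock_lastBlock (n p : ℕ) : Disjoint (firstBlock n p) (lastBlock n p) := by
  rw [Finset.disjoint_left]
  intro i
  simp [firstBlock, lastBlock]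

theorem lastBlock_self (n : ℕ) : lastBlock n n = ∅ := by
  ext i
  simp [lastBlock]

theorem lastBlock_nonempty {n p : ℕ} (h : p < n) : (lastBlock n p).Nonempty :=
  ⟨⟨p, h⟩, by simp [lastBlock]⟩

end HanEntropy

theorem proposition1 {Ω : Type*} [MeasurableSpace Ω] (μ : Measure Ω) [IsProbabilityMeasure μ]
    (n k p : ℕ) (hk : 1 ≤ k) (hkp : k ≤ p) (hpn : p ≤ n)
    (X : Fin n → Ω → ℝ) (hX : ∀ i, Measurable (X i))
    (hpdf : HasPDF (fun ω i => X i ω) μ (volume : Measure (Fin n → ℝ)))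
    (hfin : ∀ S : Finset (Fin n), HanEntropy.FiniteDiffEntropy X μ S) :
    HanEntropy.diffEntropy X μ Finset.univ ≤ HanEntropy.condHanBound X μ k p ∧
    HanEntropy.condHanBound X μ k p ≤ HanEntropy.hanBound X μ k ∧
    (k < p →
      (HanEntropy.diffEntropy X μ Finset.univ = HanEntropy.condHanBound X μ k p ↔
        HanEntropy.CondIndepGiven X μ (HanEntropy.firstBlock n p) (HanEntropy.lastBlock n p))) ∧
    (k = p → HanEntropy.diffEntropy X μ Finset.univ = HanEntropy.condHanBound X μ k p) ∧
    (p < n →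
      (HanEntropy.condHanBound X μ k p = HanEntropy.hanBound X μ k ↔
        (∀ S ⊆ HanEntropy.firstBlock n p, S.card = k → iIndepFun (fun i : S => X i) μ) ∧
        (∀ S ⊆ HanEntropy.firstBlock n p, S.card = k →
          IndepFun (HanEntropy.subvector X S)
            (HanEntropy.subvector X (HanEntropy.lastBlock n p)) μ) ∧
        iIndepFun (fun i : HanEntropy.lastBlock n p => X i) μ)) ∧
    (p = n → HanEntropy.condHanBound X μ k p = HanEntropy.hanBound X μ k) := by
  open HanEntropy in
  have hF := isSubmodular_diffEntropy hX hpdf hfin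
  have h0 := diffEntropy_empty (X := X) hpdf
  have hPL := disjoint_firstBlock_lastBlock n p
  have hU := firstBlock_union_lastBlock n p
  have hcard := card_firstBlock hpn
  have hkP : k ≤ (firstBlock n p).card := hcard.symm ▸ hkp
  have hcond : condHanBound X μ k p =
      condAverage (diffEntropy X μ) k (firstBlock n p) (lastBlock n p) := by
    simp only [condHanBound, condAverage, contract, hcard, condDiffEntropy_eq_sub hX hpdf hfin]
  have hhan : hanBound X μ k =
      condAverage (diffEntropy X μ) k (firstBlock n p ∪ lastBlock n p) ∅ := by
    simp [hanBound, condAverage, contract, hU, h0]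
  have hind : ∀ S : Finset (Fin n), iIndepFun (fun i : S => X i) μ ↔
      diffEntropy X μ S = ∑ i ∈ S, diffEntropy X μ {i} := by
    intro S
    rw [← condIndepGiven_empty_iff hX, condIndepGiven_iff_contract_eq_sum hX hpdf hfin (by simp)]
    simp [contract, h0]
  obtain ⟨h1, h2, h3⟩ := hF.le_condAverage hk (firstBlock n p) (lastBlock n p) hkP
  rw [hU] at h1 h2 h3
  rw [hcond, hhan]
  refine ⟨h1, (hF.condAverage_le h0 hk _ _ hkP hPL).1, fun hlt => ?_, fun he => h3 (he.trans
    hcard.symm), fun hlt => ?_, ?_⟩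
  · rw [h2 (hcard.symm ▸ hlt), condIndepGiven_iff_contract_eq_sum hX hpdf hfin hPL]
  · rw [hF.condAverage_eq_iff h0 hk _ _ hkP hPL (lastBlock_nonempty hlt)]
    constructor
    · intro h
      have hL : diffEntropy X μ (lastBlock n p) =
          ∑ i ∈ lastBlock n p, diffEntropy X μ {i} := by
        obtain ⟨S, hS⟩ := Finset.powersetCard_nonempty.2 hkP
        exact hF.eq_sum_of_subset h0 Finset.subset_union_right (h S hS)
      have hSi : ∀ S ⊆ firstBlock n p, S.card = k →
          diffEntropy X μ S = ∑ i ∈ S, diffEntropy X μ {i} := fun S hS hSk =>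
        hF.eq_sum_of_subset h0 Finset.subset_union_left (h S (Finset.mem_powersetCard.2 ⟨hS, hSk⟩))
      refine ⟨fun S hS hSk => (hind S).2 (hSi S hS hSk), fun S hS hSk => ?_, (hind _).2 hL⟩
      have hd := Finset.disjoint_of_subset_left hS hPL
      rw [indepFun_subvector_iff hX hpdf hfin hd, h S (Finset.mem_powersetCard.2 ⟨hS, hSk⟩),
        hSi S hS hSk, hL, Finset.sum_union hd]
    · rintro ⟨hi, hii, hiii⟩ S hS
      obtain ⟨hS, hSk⟩ := Finset.mem_powersetCard.1 hS
      have hd := Finset.disjoint_of_subset_left hS hPL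
      rw [(indepFun_subvector_iff hX hpdf hfin hd).1 (hii S hS hSk),
        (hind S).1 (hi S hS hSk), (hind _).1 hiii, Finset.sum_union hd]
  · rintro rfl
    rw [lastBlock_self, Finset.union_empty]
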